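/- **Theorem (reverse local Poincaré inequality, with sharp constant).** Let $\mathbb{H}=\mathbb{R}^3$ be the Heisenberg group, with group law $(x,y,z)\bullet(x',y',z')=\bigl(x+x',\,y+y',\,z+z'+\tfrac12(xy'-yx')\bigr)$ and left-invariant vector fields $X=\partial_x-\tfrac y2\partial_z$, $Y=\partial_y+\tfrac x2\partial_z$. Put $L=X^2+Y^2$ and $\Gamma(f,g)=(Xf)(Xg)+(Yf)(Yg)$. Let $(P_t)_{t\ge0}=(e^{tL})_{t\ge0}$ be the heat semigroup of $L$: for $f\in\mathcal C^\infty_c(\mathbb H)$ (real-valued), $(t,\mathbf x)\mapsto P_tf(\mathbf x)$ is the unique bounded continuous function $u$ on $[0,\infty)\times\mathbb H$ with $u(0,\cdot)=f$ such that, for every $t>0$, $u(t,\cdot)$ is of class $C^2$, $u$ is differentiable in $t$, and $\partial_tu=Lu$. This function exists and is unique for every $f\in\mathcal C^\infty_c(\mathbb H)$, and the following hold. 1. For every $f\in\mathcal C^\infty_c(\mathbb H)$ and every $t\ge 0$, pointwise on $\mathbb H$, $$t\,\Gamma(P_tf,P_tf)\le P_t(f^2)-(P_tf)^2 .$$ 2.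 The constant is sharp: for every $t>0$ and $\mathbf x\in\mathbb H$, if $C\in\mathbb R$ satisfies $C\,t\,\Gamma(P_tf,P_tf)(\mathbf x)\le P_t(f^2)(\mathbf x)-(P_tf)^2(\mathbf x)$ for all $f\in\mathcal C^\infty_c(\mathbb H)$, then $C\le1$. -/

import Mathlib

open scoped ContDiff

namespace Heisenberg

/-- The Heisenberg group in exponential coordinates: the point `(x, y, z)` stands for the
unipotent matrix `exp (x X + y Y + z Z)`, so the underlying manifold is `ℝ³`. -/
abbrev Point : Type := ℝ × ℝ × ℝ

/-- The group law `(x,y,z)(x',y',z') = (x + x', y + y', z + z' + (x y' - y x') / 2)`. -/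
noncomputable def mul (p q : Point) : Point :=
  (p.1 + q.1, p.2.1 + q.2.1, p.2.2 + q.2.2 + (p.1 * q.2.1 - p.2.1 * q.1) / 2)

/-- The left-invariant vector field `X = ∂_x - (y/2) ∂_z`, differentiation along right
translation by `(ε, 0, 0)`. -/
noncomputable def X (f : Point → ℝ) (p : Point) : ℝ :=
  deriv (fun ε : ℝ => f (mul p (ε, 0, 0))) 0

/-- The left-invariant vector field `Y = ∂_y + (x/2) ∂_z`, differentiation along right
translation by `(0, ε, 0)`. -/
noncomputable def Y (f : Point → ℝ) (p : Point) : ℝ :=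
  deriv (fun ε : ℝ => f (mul p (0, ε, 0))) 0

/-- The sub-Laplacian `L = X² + Y²`. -/
noncomputable def L (f : Point → ℝ) (p : Point) : ℝ :=
  X (X f) p + Y (Y f) p

/-- The carré du champ `Γ(f, g) = (X f) (X g) + (Y f) (Y g)`. -/
noncomputable def Gam (f g : Point → ℝ) (p : Point) : ℝ :=
  X f p * X g p + Y f p * Y g p

/-- `u` is a bounded classical solution on `[0, ∞)` of the heat equation `∂ₜ u = L u` with
`u 0 = f`. Values of `u` at negative times play no role. -/
structure IsHeatSolution (f : Point → ℝ) (u : ℝ → Point → ℝ) : Prop where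
  initial : u 0 = f
  continuousOn : ContinuousOn (fun q : ℝ × Point => u q.1 q.2) (Set.Ici 0 ×ˢ Set.univ)
  bounded : ∃ C : ℝ, ∀ t : ℝ, 0 ≤ t → ∀ p : Point, |u t p| ≤ C
  contDiff : ∀ t : ℝ, 0 < t → ContDiff ℝ 2 (u t)
  heat : ∀ t : ℝ, 0 < t → ∀ p : Point, HasDerivAt (fun s : ℝ => u s p) (L (u t) p) t

open Classical in
/-- The heat semigroup `P_t = e^{tL}`: `t ↦ P_t f` is the bounded solution of the heat equation
for `L` with initial value `f` (and `0` if there is none). -/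
noncomputable def P (t : ℝ) (f : Point → ℝ) : Point → ℝ :=
  if h : ∃ u : ℝ → Point → ℝ, IsHeatSolution f u then Classical.choose h t else 0

end Heisenberg

open scoped ContDiff SchwartzMap FourierTransform LineDeriv Convolution
open Set Filter Topology MeasureTheory

namespace Heisenberg

/-! Let `δ_s (x, y, z) = (s x, s y, s² z)`. The heat kernel at time `t` is `t⁻² h ∘ δ_{1/√t}` for a
probability density `h` (`heatKernel`), so `P_t f (p)` is the mean of `F v = f (p (δ_{√t} v)⁻¹)`
under `h dv`. By left invariance the vector fields fall on the kernel: `√t X P_t f (p) = ∫ F · Xh`,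
the inner product of `F` with the score `Xh / h` in `L²(h)`, and likewise for `Y`. The scores have
mean zero and turn out to be orthonormal in `L²(h)`. Part 1 is then Bessel's inequality for `F`
minus its mean (`reverse_poincare_avg`), and part 2 holds because compactly supported approximations
of `Xh / h` come arbitrarily close to equality (`reverse_poincare_sharp`).

Orthonormality comes from self-similarity. At time one the heat equation reads `L h = -(D h + 4 h) /
2` with `D = x∂_x + y∂_y + 2z∂_z` (`schwartzL_heatKernel`). Testing it against `log h` and
integrating by parts on both sides gives `∫ Γ(h, h) / h = 2` (`integral_fisher`). Invariance of `h`
under a quarter turn of the horizontal plane divides this equally between `X` and `Y` and kills the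
cross term (`integral_fisherX`, `integral_fisherY`, `integral_fisherXY`).

The kernel is constructed as the normalized Fourier transform of the explicit symbol `(cosh l)⁻¹ exp
(-(ξ² + η²) tanh l / l)`, which is a Schwartz function (`exists_heatSymbol`) satisfying the
transformed equation (`heatSymbol_equation`). A minimum principle (`nonneg_of_heat`) identifies the
averages against `h` with `P_t f` and shows `h ≥ 0`. Strict positivity of `h` is never needed, since
its gradient vanishes at its zeros. -/

/-! ### The sub-Laplacian along one-parameter flows. -/

theorem X_flow (f : Point → ℝ) (p : Point) (ε : ℝ) :
    X f (mul p (ε, 0, 0)) = deriv (fun δ => f (mul p (δ, 0, 0))) ε := by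
  have h : ∀ δ : ℝ, mul (mul p (ε, 0, 0)) (δ, 0, 0) = mul p (ε + δ, 0, 0) := by
    intro δ; simp only [mul, Prod.mk.injEq]; refine ⟨by ring, by ring, by ring⟩
  unfold X
  simp_rw [h]
  simpa using deriv_comp_const_add (f := fun δ => f (mul p (δ, 0, 0))) ε 0

theorem Y_flow (f : Point → ℝ) (p : Point) (ε : ℝ) :
    Y f (mul p (0, ε, 0)) = deriv (fun δ => f (mul p (0, δ, 0))) ε := by
  have h : ∀ δ : ℝ, mul (mul p (0, ε, 0)) (0, δ, 0) = mul p (0, ε + δ, 0) := by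
    intro δ; simp only [mul, Prod.mk.injEq]; refine ⟨by ring, by ring, by ring⟩
  unfold Y
  simp_rw [h]
  simpa using deriv_comp_const_add (f := fun δ => f (mul p (0, δ, 0))) ε 0

/-- The flow of each field is a one-parameter group, so iterating a field is the same as
differentiating twice along one curve. Linearity of `L` and its sign at a minimum thereby become
one-variable facts. -/
theorem L_eq_deriv_deriv (f : Point → ℝ) (p : Point) :
    L f p = deriv (deriv fun ε : ℝ => f (mul p (ε, 0, 0))) 0 +
      deriv (deriv fun ε : ℝ => f (mul p (0, ε, 0))) 0 := by
  have hX : (fun ε : ℝ => X f (mul p (ε, 0, 0))) = deriv fun ε : ℝ => f (mul p (ε, 0, 0)) :=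
    funext fun ε => X_flow f p ε
  have hY : (fun ε : ℝ => Y f (mul p (0, ε, 0))) = deriv fun ε : ℝ => f (mul p (0, ε, 0)) :=
    funext fun ε => Y_flow f p ε
  unfold L
  rw [← hX, ← hY]
  rfl

theorem contDiff_mul_right (q : ℝ → Point) (hq : ContDiff ℝ ∞ q) (p : Point) :
    ContDiff ℝ ∞ fun ε => mul p (q ε) := by
  unfold mul; fun_prop

theorem contDiff_flow {f : Point → ℝ} (hf : ContDiff ℝ 2 f) (p : Point) :
    ContDiff ℝ 2 (fun ε : ℝ => f (mul p (ε, 0, 0))) ∧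
      ContDiff ℝ 2 (fun ε : ℝ => f (mul p (0, ε, 0))) :=
  ⟨hf.comp ((contDiff_mul_right (fun ε => (ε, 0, 0)) (by fun_prop) p).of_le (by norm_cast)),
   hf.comp ((contDiff_mul_right (fun ε => (0, ε, 0)) (by fun_prop) p).of_le (by norm_cast))⟩

theorem deriv_deriv_add {f g : ℝ → ℝ} (hf : ContDiff ℝ 2 f) (hg : ContDiff ℝ 2 g) (x : ℝ) :
    deriv (deriv fun y => f y + g y) x = deriv (deriv f) x + deriv (deriv g) x := by
  have h1 : deriv (fun y => f y + g y) = fun y => deriv f y + deriv g y := by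
    funext y
    exact deriv_fun_add (hf.differentiable (by norm_num) y) (hg.differentiable (by norm_num) y)
  have h2 : ∀ {k : ℝ → ℝ}, ContDiff ℝ 2 k → Differentiable ℝ (deriv k) := fun {k} hk =>
    ((contDiff_succ_iff_deriv (n := 1)).1 hk).2.2.differentiable (by norm_num)
  rw [h1]
  exact deriv_fun_add (h2 hf x) (h2 hg x)

theorem L_add {f g : Point → ℝ} (hf : ContDiff ℝ 2 f) (hg : ContDiff ℝ 2 g) (p : Point) :
    L (fun q => f q + g q) p = L f p + L g p := by
  simp only [L_eq_deriv_deriv]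
  rw [deriv_deriv_add (contDiff_flow hf p).1 (contDiff_flow hg p).1,
    deriv_deriv_add (contDiff_flow hf p).2 (contDiff_flow hg p).2]
  ring

theorem L_const_mul (c : ℝ) (f : Point → ℝ) (p : Point) :
    L (fun q => c * f q) p = c * L f p := by
  simp only [L_eq_deriv_deriv, deriv_const_mul_field']
  ring

/-- A negative second derivative would make the minimum a local maximum as well; the function would
then be locally constant and its second derivative zero. -/
theorem deriv_deriv_nonneg_of_isMin {g : ℝ → ℝ} (hg : ContDiff ℝ 2 g) {x : ℝ}
    (hx : ∀ y, g x ≤ g y) : 0 ≤ deriv (deriv g) x := by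
  by_contra! hneg
  have hmin : IsLocalMin g x := Eventually.of_forall hx
  have h1 : IsLocalMax g x := by
    have hd : deriv (deriv fun y => -g y) x > 0 := by
      have : (deriv fun y => -g y) = fun y => -deriv g y := by funext y; exact deriv.fun_neg
      rw [this, deriv.fun_neg]; linarith
    have := isLocalMin_of_deriv_deriv_pos hd
      (by rw [deriv.fun_neg, hmin.deriv_eq_zero, neg_zero]) hg.continuous.neg.continuousAt
    simpa using this.neg
  have h2 : g =ᶠ[𝓝 x] fun _ => g x := by
    filter_upwards [h1] with y hy using le_antisymm hy (hx y)
  have h3 := h2.deriv.deriv.eq_of_nhds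
  simp at h3
  linarith

theorem L_nonneg_of_isMin {f : Point → ℝ} (hf : ContDiff ℝ 2 f) {p : Point}
    (hp : ∀ q, f p ≤ f q) : 0 ≤ L f p := by
  have h0 : mul p (0, 0, 0) = p := by simp [mul]
  rw [L_eq_deriv_deriv]
  refine add_nonneg (deriv_deriv_nonneg_of_isMin (contDiff_flow hf p).1 fun y => ?_)
    (deriv_deriv_nonneg_of_isMin (contDiff_flow hf p).2 fun y => ?_)
  · rw [h0]; exact hp _
  · rw [h0]; exact hp _

/-! ### Minimum principle and uniqueness of bounded solutions. -/

/-- A Lyapunov function for `L`. -/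
noncomputable def lyap (p : Point) : ℝ := 1 + p.1 ^ 2 + p.2.1 ^ 2 + p.2.2 ^ 2

theorem contDiff_lyap : ContDiff ℝ ∞ lyap := by unfold lyap; fun_prop

theorem one_le_lyap (p : Point) : 1 ≤ lyap p := by unfold lyap; nlinarith [sq_nonneg p.1, sq_nonneg p.2.1, sq_nonneg p.2.2]

theorem deriv_deriv_quadratic (a b c : ℝ) :
    deriv (deriv fun ε : ℝ => a + b * ε + c * ε ^ 2) 0 = 2 * c := by
  have h1 : (deriv fun ε : ℝ => a + b * ε + c * ε ^ 2) = fun ε => b + 2 * c * ε := by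
    funext ε
    have := (((hasDerivAt_id ε).const_mul b).const_add a).add (((hasDerivAt_id ε).pow 2).const_mul c)
    refine (this.congr_deriv ?_).deriv
    simp; ring
  rw [h1]
  simp

theorem L_lyap (p : Point) : L lyap p = 4 + (p.1 ^ 2 + p.2.1 ^ 2) / 2 := by
  rw [L_eq_deriv_deriv]
  have h1 : (fun ε : ℝ => lyap (mul p (ε, 0, 0))) =
      fun ε => lyap p + (2 * p.1 - p.2.2 * p.2.1) * ε + (1 + p.2.1 ^ 2 / 4) * ε ^ 2 := by
    funext ε; simp only [lyap, mul]; ring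
  have h2 : (fun ε : ℝ => lyap (mul p (0, ε, 0))) =
      fun ε => lyap p + (2 * p.2.1 + p.2.2 * p.1) * ε + (1 + p.1 ^ 2 / 4) * ε ^ 2 := by
    funext ε; simp only [lyap, mul]; ring
  rw [h1, h2, deriv_deriv_quadratic, deriv_deriv_quadratic]
  ring

theorem L_lyap_le (p : Point) : L lyap p ≤ 4 * lyap p := by
  rw [L_lyap]; unfold lyap; nlinarith [sq_nonneg p.1, sq_nonneg p.2.1, sq_nonneg p.2.2]

theorem sq_norm_le_lyap (p : Point) : ‖p‖ ^ 2 ≤ lyap p := by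
  have h : ‖p‖ ≤ Real.sqrt (lyap p) := by
    rw [Prod.norm_def, Prod.norm_def, max_le_iff, max_le_iff]
    simp only [Real.norm_eq_abs, lyap]
    refine ⟨Real.abs_le_sqrt ?_, Real.abs_le_sqrt ?_, Real.abs_le_sqrt ?_⟩ <;>
      nlinarith [sq_nonneg p.1, sq_nonneg p.2.1, sq_nonneg p.2.2]
  calc ‖p‖ ^ 2 ≤ Real.sqrt (lyap p) ^ 2 := by gcongr
    _ = lyap p := Real.sq_sqrt (zero_le_one.trans (one_le_lyap p))

/-- Only left difference quotients are used, since the minimum may sit at the right endpoint. -/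
theorem hasDerivAt_nonpos_of_min_Icc {g : ℝ → ℝ} {g' T t : ℝ} (hg : HasDerivAt g g' t)
    (ht : t ∈ Ioc 0 T) (hmin : ∀ s ∈ Icc 0 T, g t ≤ g s) : g' ≤ 0 := by
  have h1 := hg.tendsto_slope
  have h2 : Tendsto (slope g t) (𝓝[<] t) (𝓝 g') :=
    h1.mono_left (nhdsWithin_mono _ fun x hx => ne_of_lt hx)
  refine le_of_tendsto h2 ?_
  filter_upwards [Ioo_mem_nhdsLT ht.1] with s hs
  rw [slope_def_field]
  exact div_nonpos_of_nonneg_of_nonpos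
    (sub_nonneg.2 (hmin s ⟨hs.1.le, hs.2.le.trans ht.2⟩)) (by linarith [hs.2])

/-- Minimum principle for bounded solutions of the heat equation. -/
theorem nonneg_of_heat {u : ℝ → Point → ℝ} {C : ℝ}
    (hc : ContinuousOn (fun q : ℝ × Point => u q.1 q.2) (Ici 0 ×ˢ univ))
    (hb : ∀ t, 0 ≤ t → ∀ p, |u t p| ≤ C) (h2 : ∀ t, 0 < t → ContDiff ℝ 2 (u t))
    (hh : ∀ t, 0 < t → ∀ p, HasDerivAt (fun s => u s p) (L (u t) p) t)
    (h0 : ∀ p, 0 ≤ u 0 p) {t : ℝ} (ht : 0 ≤ t) (p : Point) : 0 ≤ u t p := by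
  have key : ∀ ε : ℝ, 0 < ε → 0 ≤ u t p + ε * Real.exp (5 * t) * lyap p := by
    intro ε hε
    by_contra! hneg
    set w : ℝ → Point → ℝ := fun s q => u s q + ε * Real.exp (5 * s) * lyap q with hw
    -- Outside this radius `ε * lyap` exceeds `|C|`, so `w` is positive there; the ball also
    -- contains `p`. A negative value of `w` therefore forces a global minimum inside the ball.
    set R : ℝ := Real.sqrt (|C| / ε) + ‖p‖ + 1 with hR
    have hout : ∀ s, 0 ≤ s → ∀ q, R < ‖q‖ → 0 < w s q := by
      intro s hs q hq
      have h1 := (abs_le.1 (hb s hs q)).1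
      have h3 : |C| / ε < ‖q‖ ^ 2 := by
        have : Real.sqrt (|C| / ε) < ‖q‖ := by have := norm_nonneg p; linarith
        calc |C| / ε = Real.sqrt (|C| / ε) ^ 2 := (Real.sq_sqrt (by positivity)).symm
          _ < ‖q‖ ^ 2 := by gcongr
      have h4 : |C| < ε * lyap q := by
        rw [div_lt_iff₀ hε] at h3
        nlinarith [sq_norm_le_lyap q]
      have h5 : 1 ≤ Real.exp (5 * s) := Real.one_le_exp (by positivity)
      have h6 : ε * lyap q ≤ ε * Real.exp (5 * s) * lyap q := by
        have := one_le_lyap q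
        nlinarith [mul_nonneg hε.le (by linarith : 0 ≤ lyap q)]
      simp only [hw]
      linarith [le_abs_self C]
    have hK : IsCompact (Icc 0 t ×ˢ Metric.closedBall (0 : Point) R) :=
      isCompact_Icc.prod (isCompact_closedBall _ _)
    have hwc : ContinuousOn (fun q : ℝ × Point => w q.1 q.2) (Icc 0 t ×ˢ Metric.closedBall 0 R) := by
      refine ContinuousOn.add (hc.mono (prod_mono (fun s hs => hs.1) (subset_univ _))) ?_
      have := contDiff_lyap.continuous
      fun_prop
    have hpR : p ∈ Metric.closedBall (0 : Point) R := by
      rw [mem_closedBall_zero_iff]; have := Real.sqrt_nonneg (|C| / ε); linarith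
    obtain ⟨⟨s, q⟩, ⟨hs, hq⟩, hmin⟩ := hK.exists_isMinOn ⟨(t, p), ⟨⟨ht, le_rfl⟩, hpR⟩⟩ hwc
    have hlt : w s q < 0 := lt_of_le_of_lt (isMinOn_iff.1 hmin (t, p) ⟨⟨ht, le_rfl⟩, hpR⟩) hneg
    simp only at hs
    have hmin' : ∀ s' ∈ Icc 0 t, ∀ q', w s q ≤ w s' q' := by
      intro s' hs' q'
      by_cases hq' : ‖q'‖ ≤ R
      · exact isMinOn_iff.1 hmin (s', q') ⟨hs', by simpa using hq'⟩
      · exact hlt.le.trans (hout s' hs'.1 q' (not_le.1 hq')).le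
    have hs0 : 0 < s := by
      rcases hs.1.eq_or_lt with h | h
      · exfalso
        have h7 : 0 ≤ w s q := by
          rw [← h]
          have := one_le_lyap q
          have := h0 q
          simp only [hw]; positivity
        linarith
      · exact h
    have hly : ContDiff ℝ 2 lyap := contDiff_lyap.of_le (by norm_cast)
    have hL : 0 ≤ L (w s) q :=
      L_nonneg_of_isMin ((h2 s hs0).add (contDiff_const.mul hly)) (hmin' s hs)
    rw [hw, L_add (h2 s hs0) (contDiff_const.mul hly), L_const_mul] at hL
    have hd : HasDerivAt (fun s' => w s' q)
        (L (u s) q + ε * (Real.exp (5 * s) * 5) * lyap q) s := by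
      refine (hh s hs0 q).add (HasDerivAt.mul_const (HasDerivAt.const_mul ε ?_) _)
      have := ((hasDerivAt_id s).const_mul 5).exp
      simpa using this
    have hd' := hasDerivAt_nonpos_of_min_Icc hd ⟨hs0, hs.2⟩ fun s' hs' => hmin' s' hs' q
    have h8 : 0 < ε * Real.exp (5 * s) := by positivity
    -- The minimum gives `∂ₜ w ≤ 0 ≤ L w`, hence `5 lyap q ≤ L lyap q`, while `L lyap ≤ 4 lyap`.
    -- This is why the exponential rate is `5`.
    nlinarith [L_lyap_le q, one_le_lyap q]
  refine le_of_forall_pos_le_add fun δ hδ => ?_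
  have hpos : 0 < Real.exp (5 * t) * lyap p :=
    mul_pos (Real.exp_pos _) (zero_lt_one.trans_le (one_le_lyap p))
  have := key (δ / (Real.exp (5 * t) * lyap p)) (by positivity)
  rwa [mul_assoc, div_mul_cancel₀ _ hpos.ne'] at this

theorem IsHeatSolution.le {f : Point → ℝ} {u v : ℝ → Point → ℝ} (hu : IsHeatSolution f u)
    (hv : IsHeatSolution f v) {t : ℝ} (ht : 0 ≤ t) (p : Point) : u t p ≤ v t p := by
  obtain ⟨A, hA⟩ := hu.bounded
  obtain ⟨B, hB⟩ := hv.bounded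
  have := nonneg_of_heat (u := fun s q => v s q + (-1) * u s q) (C := B + A)
    (hv.continuousOn.add (continuousOn_const.mul hu.continuousOn))
    (fun s hs q => by
      have h1 := hA s hs q
      have h2 := hB s hs q
      calc |v s q + (-1) * u s q| ≤ |v s q| + |(-1) * u s q| := abs_add_le _ _
        _ = |v s q| + |u s q| := by rw [neg_one_mul, abs_neg]
        _ ≤ B + A := add_le_add h2 h1)
    (fun s hs => (hv.contDiff s hs).add (contDiff_const.mul (hu.contDiff s hs)))
    (fun s hs q => by
      rw [L_add (hv.contDiff s hs) (contDiff_const.mul (hu.contDiff s hs)), L_const_mul]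
      exact (hv.heat s hs q).add ((hu.heat s hs q).const_mul _))
    (fun q => by simp [hu.initial, hv.initial]) ht p
  linarith

theorem IsHeatSolution.unique {f : Point → ℝ} {u v : ℝ → Point → ℝ} (hu : IsHeatSolution f u)
    (hv : IsHeatSolution f v) {t : ℝ} (ht : 0 ≤ t) : u t = v t :=
  funext fun p => le_antisymm (hu.le hv ht p) (hv.le hu ht p)

/-- The choice made in `P` depends on `f` but not on `t`, so all times come from one and the same
solution. -/
theorem IsHeatSolution.isHeatSolution_P {f : Point → ℝ} {u : ℝ → Point → ℝ}
    (hu : IsHeatSolution f u) : IsHeatSolution f fun t => P t f := by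
  have h : ∃ u : ℝ → Point → ℝ, IsHeatSolution f u := ⟨u, hu⟩
  have : (fun t => P t f) = Classical.choose h := by
    funext t; simp only [P, dif_pos h]
  rw [this]
  exact Classical.choose_spec h

theorem IsHeatSolution.eq_P {f : Point → ℝ} {u : ℝ → Point → ℝ} (hu : IsHeatSolution f u)
    {t : ℝ} (ht : 0 ≤ t) : u t = P t f :=
  hu.unique hu.isHeatSolution_P ht

/-! ### A criterion for `exp (-Q)` to be a Schwartz function. -/

section Growth

variable {E : Type*} [NormedAddCommGroup E] [NormedSpace ℝ E]

/-- Induction on the order: Leibniz applied to `f' = f • v` bounds each new derivative by the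
earlier ones, and the binomial coefficients sum to `2 ^ n`. Rapid decay of `f` alone then controls
all its derivatives. -/
theorem norm_iteratedFDeriv_le_of_fderiv_eq_smul {f : E → ℝ} {v : E → E →L[ℝ] ℝ}
    (hf : ContDiff ℝ ∞ f) (hfv : fderiv ℝ f = fun x => f x • v x)
    (hv : v.HasTemperateGrowth) (n : ℕ) :
    ∃ (k : ℕ) (C : ℝ), 0 ≤ C ∧
      ∀ m ≤ n, ∀ x, ‖iteratedFDeriv ℝ m f x‖ ≤ C * (1 + ‖x‖) ^ k * |f x| := by
  induction n with
  | zero =>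
    refine ⟨0, 1, zero_le_one, fun m hm x => ?_⟩
    obtain rfl : m = 0 := by omega
    simp
  | succ n ih =>
    obtain ⟨k, C, hC, h⟩ := ih
    obtain ⟨l, D, hD, hvb⟩ := hv.norm_iteratedFDeriv_le_uniform n
    refine ⟨k + l, C + 2 ^ n * (C * D), by positivity, fun m hm x => ?_⟩
    have h1 : 1 ≤ (1 + ‖x‖) ^ l := one_le_pow₀ (by linarith [norm_nonneg x])
    rcases Nat.lt_or_ge n m with hnm | hnm
    · obtain rfl : m = n + 1 := by omega
      have h2 : ‖iteratedFDeriv ℝ (n + 1) f x‖ = ‖iteratedFDeriv ℝ n (fun y => f y • v y) x‖ := by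
        rw [← norm_iteratedFDeriv_fderiv, hfv]
      rw [h2]
      calc ‖iteratedFDeriv ℝ n (fun y => f y • v y) x‖
          ≤ ∑ i ∈ Finset.range (n + 1), (n.choose i : ℝ) * ‖iteratedFDeriv ℝ i f x‖ *
              ‖iteratedFDeriv ℝ (n - i) v x‖ :=
            norm_iteratedFDeriv_smul_le hf hv.1 x (by exact_mod_cast le_top)
        _ ≤ ∑ i ∈ Finset.range (n + 1), (n.choose i : ℝ) * (C * (1 + ‖x‖) ^ k * |f x|) *
              (D * (1 + ‖x‖) ^ l) := by
            refine Finset.sum_le_sum fun i hi => ?_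
            have hi' : i ≤ n := by simpa [Nat.lt_succ_iff] using hi
            gcongr
            · exact h i hi' x
            · exact hvb _ (Nat.sub_le _ _) x
        _ = 2 ^ n * (C * D) * (1 + ‖x‖) ^ (k + l) * |f x| := by
            rw [← Finset.sum_mul, ← Finset.sum_mul]
            have : ∑ i ∈ Finset.range (n + 1), (n.choose i : ℝ) = 2 ^ n := by
              exact_mod_cast Nat.sum_range_choose n
            rw [this]; ring
        _ ≤ (C + 2 ^ n * (C * D)) * (1 + ‖x‖) ^ (k + l) * |f x| := by
            gcongr; linarith
    · calc ‖iteratedFDeriv ℝ m f x‖ ≤ C * (1 + ‖x‖) ^ k * |f x| := h m hnm x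
        _ ≤ (C + 2 ^ n * (C * D)) * (1 + ‖x‖) ^ (k + l) * |f x| := by
            have : 0 ≤ 2 ^ n * (C * D) := by positivity
            gcongr
            · linarith
            · linarith [norm_nonneg x]
            · omega

/-- `exp (-Q)` is a Schwartz function if it decays rapidly and the derivative of `Q` has temperate
growth. -/
theorem exists_schwartzMap_exp_neg {Q : E → ℝ} (hQ : Differentiable ℝ Q)
    (hQ' : (fderiv ℝ Q).HasTemperateGrowth)
    (hdec : ∀ k : ℕ, ∃ C, ∀ x, (1 + ‖x‖) ^ k * Real.exp (-Q x) ≤ C) :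
    ∃ Φ : 𝓢(E, ℝ), ∀ x, Φ x = Real.exp (-Q x) := by
  have hQs : ContDiff ℝ ∞ Q := contDiff_infty_iff_fderiv.2 ⟨hQ, hQ'.1⟩
  have hs : ContDiff ℝ ∞ fun x => Real.exp (-Q x) := hQs.neg.exp
  have hd : fderiv ℝ (fun x => Real.exp (-Q x)) = fun x => Real.exp (-Q x) • (-fderiv ℝ Q x) := by
    funext x
    exact ((hQ x).hasFDerivAt.neg.exp).fderiv
  refine ⟨⟨fun x => Real.exp (-Q x), hs, fun k n => ?_⟩, fun x => rfl⟩
  obtain ⟨l, C, hC, h⟩ := norm_iteratedFDeriv_le_of_fderiv_eq_smul hs hd hQ'.neg n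
  obtain ⟨D, hD⟩ := hdec (k + l)
  refine ⟨C * D, fun x => ?_⟩
  calc ‖x‖ ^ k * ‖iteratedFDeriv ℝ n (fun x => Real.exp (-Q x)) x‖
      ≤ (1 + ‖x‖) ^ k * (C * (1 + ‖x‖) ^ l * |Real.exp (-Q x)|) := by
        gcongr
        · linarith
        · exact h n le_rfl x
    _ = C * ((1 + ‖x‖) ^ (k + l) * Real.exp (-Q x)) := by
        rw [abs_of_pos (Real.exp_pos _)]; ring
    _ ≤ C * D := by gcongr; exact hD x

end Growth

/-! ### Bounded derivatives of `tanh l` and `tanh l / l`. -/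

/-- `f` is `n` times differentiable with bounded derivatives of order at most `n`. -/
def BddDeriv : ℕ → (ℝ → ℝ) → Prop
  | 0, f => ∃ C, ∀ x, |f x| ≤ C
  | n + 1, f => (∃ C, ∀ x, |f x| ≤ C) ∧ ∃ f' : ℝ → ℝ, (∀ x, HasDerivAt f (f' x) x) ∧ BddDeriv n f'

namespace BddDeriv

theorem bounded {n : ℕ} {f : ℝ → ℝ} (h : BddDeriv n f) : ∃ C, ∀ x, |f x| ≤ C := by
  cases n with
  | zero => exact h
  | succ n => exact h.1

theorem of_succ {n : ℕ} : ∀ {f : ℝ → ℝ}, BddDeriv (n + 1) f → BddDeriv n f := by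
  induction n with
  | zero => exact fun h => h.1
  | succ n ih =>
    rintro f ⟨h, f', hf, hf'⟩
    exact ⟨h, f', hf, ih hf'⟩

theorem const (c : ℝ) (n : ℕ) : BddDeriv n fun _ => c := by
  induction n generalizing c with
  | zero => exact ⟨|c|, fun _ => le_rfl⟩
  | succ n ih => exact ⟨⟨|c|, fun _ => le_rfl⟩, fun _ => 0, fun x => hasDerivAt_const x c, ih 0⟩

theorem add {n : ℕ} : ∀ {f g : ℝ → ℝ}, BddDeriv n f → BddDeriv n g →
    BddDeriv n fun x => f x + g x := by
  have h0 : ∀ {f g : ℝ → ℝ}, (∃ C, ∀ x, |f x| ≤ C) → (∃ C, ∀ x, |g x| ≤ C) →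
      ∃ C, ∀ x, |f x + g x| ≤ C := by
    rintro f g ⟨C, hC⟩ ⟨D, hD⟩
    exact ⟨C + D, fun x => (abs_add_le _ _).trans (add_le_add (hC x) (hD x))⟩
  induction n with
  | zero => exact h0
  | succ n ih =>
    rintro f g ⟨h, f', hf, hf'⟩ ⟨k, g', hg, hg'⟩
    exact ⟨h0 h k, _, fun x => (hf x).add (hg x), ih hf' hg'⟩

theorem mul {n : ℕ} : ∀ {f g : ℝ → ℝ}, BddDeriv n f → BddDeriv n g →
    BddDeriv n fun x => f x * g x := by
  have h0 : ∀ {f g : ℝ → ℝ}, (∃ C, ∀ x, |f x| ≤ C) → (∃ C, ∀ x, |g x| ≤ C) →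
      ∃ C, ∀ x, |f x * g x| ≤ C := by
    rintro f g ⟨C, hC⟩ ⟨D, hD⟩
    refine ⟨C * D, fun x => ?_⟩
    rw [abs_mul]
    exact mul_le_mul (hC x) (hD x) (abs_nonneg _) ((abs_nonneg _).trans (hC x))
  induction n with
  | zero => exact h0
  | succ n ih =>
    intro f g hf hg
    obtain ⟨h, f', hf1, hf'⟩ := id hf
    obtain ⟨k, g', hg1, hg'⟩ := id hg
    exact ⟨h0 h k, _, fun x => (hf1 x).mul (hg1 x), (ih hf' hg.of_succ).add (ih hf.of_succ hg')⟩

theorem sub {n : ℕ} {f g : ℝ → ℝ} (hf : BddDeriv n f) (hg : BddDeriv n g) :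
    BddDeriv n fun x => f x - g x := by
  have := hf.add ((const (-1) n).mul hg)
  simpa [sub_eq_add_neg] using this

theorem contDiff {n : ℕ} : ∀ {f : ℝ → ℝ}, BddDeriv (n + 1) f → ContDiff ℝ n f := by
  induction n with
  | zero =>
    rintro f ⟨-, f', hf, -⟩
    exact contDiff_zero.2 (continuous_iff_continuousAt.2 fun x => (hf x).continuousAt)
  | succ n ih =>
    rintro f ⟨-, f', hf, hf'⟩
    have hd : deriv f = f' := funext fun x => (hf x).deriv
    have : ContDiff ℝ ((n : WithTop ℕ∞) + 1) f :=
      contDiff_succ_iff_deriv.2 ⟨fun x => (hf x).differentiableAt, by simp, hd ▸ ih hf'⟩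
    exact_mod_cast this

theorem bounded_iteratedDeriv {n : ℕ} : ∀ {f : ℝ → ℝ}, BddDeriv n f →
    ∃ C, ∀ x, |iteratedDeriv n f x| ≤ C := by
  induction n with
  | zero => intro f h; simpa using h.bounded
  | succ n ih =>
    rintro f ⟨-, f', hf, hf'⟩
    rw [iteratedDeriv_succ', show deriv f = f' from funext fun x => (hf x).deriv]
    exact ih hf'

theorem hasTemperateGrowth {f : ℝ → ℝ} (h : ∀ n, BddDeriv n f) : f.HasTemperateGrowth := by
  refine ⟨contDiff_infty.2 fun n => (h (n + 1)).contDiff, fun n => ?_⟩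
  obtain ⟨C, hC⟩ := (h n).bounded_iteratedDeriv
  refine ⟨0, C, fun x => ?_⟩
  rw [norm_iteratedFDeriv_eq_norm_iteratedDeriv]
  simpa using hC x

end BddDeriv

theorem hasDerivAt_tanh (x : ℝ) : HasDerivAt Real.tanh (1 - Real.tanh x * Real.tanh x) x := by
  have h := (Real.hasDerivAt_sinh x).div (Real.hasDerivAt_cosh x) (Real.cosh_pos x).ne'
  have h2 : Real.tanh = Real.sinh / Real.cosh := by
    funext y; rw [Pi.div_apply, Real.tanh_eq_sinh_div_cosh]
  rw [h2]
  refine h.congr_deriv ?_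
  have := (Real.cosh_pos x).ne'
  simp only [Pi.div_apply]
  field_simp

theorem bddDeriv_tanh (n : ℕ) : BddDeriv n Real.tanh := by
  have hb : ∃ C, ∀ x, |Real.tanh x| ≤ C := ⟨1, fun x => (Real.abs_tanh_lt_one x).le⟩
  induction n with
  | zero => exact hb
  | succ n ih => exact ⟨hb, _, hasDerivAt_tanh, (BddDeriv.const 1 n).sub (ih.mul ih)⟩

/-- The moments `∫_{-1}^1 u^j e^{lu} du`. -/
noncomputable def expMoment (j : ℕ) (l : ℝ) : ℝ := ∫ u in (-1 : ℝ)..1, u ^ j * Real.exp (l * u)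

theorem hasDerivAt_expMoment (j : ℕ) (l : ℝ) :
    HasDerivAt (expMoment j) (expMoment (j + 1) l) l := by
  have h := intervalIntegral.hasDerivAt_integral_of_dominated_loc_of_deriv_le
    (μ := volume) (a := (-1 : ℝ)) (b := 1)
    (F := fun l u => u ^ j * Real.exp (l * u)) (F' := fun l u => u ^ (j + 1) * Real.exp (l * u))
    (x₀ := l) (s := Metric.ball l 1) (bound := fun _ => Real.exp (|l| + 1))
    (Metric.ball_mem_nhds l one_pos)
    (Eventually.of_forall fun l => (by fun_prop : Continuous _).aestronglyMeasurable)
    ((by fun_prop : Continuous _).intervalIntegrable _ _)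
    ((by fun_prop : Continuous _).aestronglyMeasurable)
    (Eventually.of_forall fun u hu l' hl' => ?_)
    (by simp)
    (Eventually.of_forall fun u hu l' hl' => ?_)
  · exact h.2
  · rw [uIoc_of_le (by norm_num)] at hu
    have hu1 : |u| ≤ 1 := abs_le.2 ⟨hu.1.le, hu.2⟩
    have h1 : |u| ^ (j + 1) ≤ 1 := pow_le_one₀ (abs_nonneg _) hu1
    have h2 : l' * u ≤ |l| + 1 := by
      have h3 : |l'| ≤ |l| + 1 := by
        rw [Metric.mem_ball, Real.dist_eq] at hl'
        have := abs_sub_abs_le_abs_sub l' l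
        linarith
      calc l' * u ≤ |l' * u| := le_abs_self _
        _ = |l'| * |u| := abs_mul _ _
        _ ≤ |l'| * 1 := by gcongr
        _ ≤ |l| + 1 := by linarith
    rw [norm_mul, norm_pow, Real.norm_eq_abs, Real.norm_eq_abs, Real.abs_exp]
    calc |u| ^ (j + 1) * Real.exp (l' * u) ≤ 1 * Real.exp (|l| + 1) := by gcongr
      _ = _ := one_mul _
  · have := ((hasDerivAt_id l').mul_const u).exp.const_mul (u ^ j)
    refine this.congr_deriv ?_
    simp only [id]; ring

theorem mul_expMoment_zero (l : ℝ) : l * expMoment 0 l = 2 * Real.sinh l := by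
  have h : ∀ u ∈ uIcc (-1 : ℝ) 1,
      HasDerivAt (fun u => Real.exp (l * u)) (l * Real.exp (l * u)) u := by
    intro u _
    have := ((hasDerivAt_id u).const_mul l).exp
    refine this.congr_deriv ?_
    simp only [id]; ring
  have h1 := intervalIntegral.integral_eq_sub_of_hasDerivAt h
    ((by fun_prop : Continuous _).intervalIntegrable _ _)
  rw [intervalIntegral.integral_const_mul] at h1
  simp only [expMoment, pow_zero, one_mul]
  rw [h1, Real.sinh_eq]
  simp; ring

/-- Differentiate the identity `l * expMoment 0 l = 2 * sinh l`. -/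
theorem mul_expMoment_one (l : ℝ) : l * expMoment 1 l = 2 * Real.cosh l - expMoment 0 l := by
  have h1 := (hasDerivAt_id l).mul (hasDerivAt_expMoment 0 l)
  have h2 : (id * expMoment 0 : ℝ → ℝ) = fun l => 2 * Real.sinh l := by
    funext l; exact mul_expMoment_zero l
  rw [h2] at h1
  have h3 := h1.unique ((Real.hasDerivAt_sinh l).const_mul 2)
  simp only [id] at h3
  linarith

theorem abs_expMoment_le (j : ℕ) (l : ℝ) : |expMoment j l| ≤ expMoment 0 l := by
  refine (intervalIntegral.abs_integral_le_integral_abs (by norm_num)).trans ?_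
  refine intervalIntegral.integral_mono_on (by norm_num)
    ((by fun_prop : Continuous _).intervalIntegrable _ _)
    ((by fun_prop : Continuous _).intervalIntegrable _ _) fun u hu => ?_
  rw [abs_mul, Real.abs_exp, abs_pow]
  gcongr
  simpa using pow_le_one₀ (abs_nonneg u) (abs_le.2 hu)

theorem expMoment_zero_le (l : ℝ) : expMoment 0 l ≤ 4 * Real.cosh l := by
  have h : expMoment 0 l ≤ ∫ _u in (-1 : ℝ)..1, 2 * Real.cosh l := by
    refine intervalIntegral.integral_mono_on (by norm_num)
      ((by fun_prop : Continuous _).intervalIntegrable _ _) (by simp) fun u hu => ?_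
    rw [pow_zero, one_mul, Real.cosh_eq]
    have h1 := Real.exp_pos l
    have h2 := Real.exp_pos (-l)
    rcases le_total 0 l with hl | hl
    · have : Real.exp (l * u) ≤ Real.exp l := Real.exp_le_exp.2 (by nlinarith [hu.2])
      linarith
    · have : Real.exp (l * u) ≤ Real.exp (-l) := Real.exp_le_exp.2 (by nlinarith [hu.1])
      linarith
  refine h.trans (le_of_eq ?_)
  rw [intervalIntegral.integral_const]; norm_num; ring

/-- Follows from `mul_expMoment_one` and `|expMoment 1| ≤ expMoment 0`. It yields the lower bound `1
/ (1 + |l|)` for `tanh l / l` with no special case at `l = 0`. -/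
theorem cosh_le_expMoment (l : ℝ) : 2 * Real.cosh l ≤ (1 + |l|) * expMoment 0 l := by
  have h1 := mul_expMoment_one l
  have h2 : l * expMoment 1 l ≤ |l| * expMoment 0 l := by
    calc l * expMoment 1 l ≤ |l * expMoment 1 l| := le_abs_self _
      _ = |l| * |expMoment 1 l| := abs_mul _ _
      _ ≤ _ := by gcongr; exact abs_expMoment_le 1 l
  linarith

/-- `normMoment 0 l = tanh l / l`. -/
noncomputable def normMoment (j : ℕ) (l : ℝ) : ℝ := expMoment j l / (2 * Real.cosh l)

theorem hasDerivAt_normMoment (j : ℕ) (l : ℝ) :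
    HasDerivAt (normMoment j) (normMoment (j + 1) l - normMoment j l * Real.tanh l) l := by
  have hc := (Real.cosh_pos l).ne'
  refine ((hasDerivAt_expMoment j l).div ((Real.hasDerivAt_cosh l).const_mul 2)
    (by positivity)).congr_deriv ?_
  rw [normMoment, normMoment, Real.tanh_eq_sinh_div_cosh]
  field_simp

/-- Differentiation raises `j` by one and produces a factor `tanh`, so the induction on the order
treats all `j` at once. The integral form of the moments removes the apparent singularity of `tanh l
/ l` at zero. -/
theorem bddDeriv_normMoment (n : ℕ) : ∀ j, BddDeriv n (normMoment j) := by
  have hb : ∀ j, ∃ C, ∀ x, |normMoment j x| ≤ C := fun j => ⟨2, fun x => by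
    have hc := Real.cosh_pos x
    rw [normMoment, abs_div, abs_of_pos (by positivity : 0 < 2 * Real.cosh x),
      div_le_iff₀ (by positivity)]
    linarith [abs_expMoment_le j x, expMoment_zero_le x]⟩
  induction n with
  | zero => exact hb
  | succ n ih =>
    exact fun j => ⟨hb j, _, hasDerivAt_normMoment j, (ih (j + 1)).sub ((ih j).mul (bddDeriv_tanh n))⟩

theorem mul_normMoment_zero (l : ℝ) : l * normMoment 0 l = Real.tanh l := by
  have hc := (Real.cosh_pos l).ne'
  rw [normMoment, ← mul_div_assoc, mul_expMoment_zero, Real.tanh_eq_sinh_div_cosh]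
  field_simp

theorem mul_normMoment_one (l : ℝ) : l * normMoment 1 l = 1 - normMoment 0 l := by
  have hc := (Real.cosh_pos l).ne'
  rw [normMoment, normMoment, ← mul_div_assoc, mul_expMoment_one]
  field_simp

theorem inv_le_normMoment_zero (l : ℝ) : 1 / (1 + |l|) ≤ normMoment 0 l := by
  have hc := Real.cosh_pos l
  rw [normMoment, div_le_div_iff₀ (by positivity) (by positivity)]
  linarith [cosh_le_expMoment l]

/-! ### The Fourier symbol of the heat kernel is Schwartz. -/

/-- The frequency space. -/
abbrev Freq : Type := EuclideanSpace ℝ (Fin 3)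

/-- The exponent of the Fourier transform of the heat kernel. -/
noncomputable def heatExponent (v : Freq) : ℝ :=
  Real.log (Real.cosh (v 2)) + (v 0 ^ 2 + v 1 ^ 2) * normMoment 0 (v 2)

/-- The derivative of `heatExponent`. -/
noncomputable def heatExponentDeriv (v : Freq) : Freq →L[ℝ] ℝ :=
  (Real.tanh (v 2) + (v 0 ^ 2 + v 1 ^ 2) *
      (normMoment 1 (v 2) - normMoment 0 (v 2) * Real.tanh (v 2))) •
      EuclideanSpace.proj (𝕜 := ℝ) (2 : Fin 3)
    + (2 * v 0 * normMoment 0 (v 2)) • EuclideanSpace.proj (𝕜 := ℝ) (0 : Fin 3)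
    + (2 * v 1 * normMoment 0 (v 2)) • EuclideanSpace.proj (𝕜 := ℝ) (1 : Fin 3)

theorem hasFDerivAt_coord (i : Fin 3) (v : Freq) :
    HasFDerivAt (fun w : Freq => w i) (EuclideanSpace.proj (𝕜 := ℝ) i : Freq →L[ℝ] ℝ) v :=
  (EuclideanSpace.proj (𝕜 := ℝ) i : Freq →L[ℝ] ℝ).hasFDerivAt

theorem hasFDerivAt_heatExponent (v : Freq) :
    HasFDerivAt heatExponent (heatExponentDeriv v) v := by
  have h1 : HasDerivAt (fun l => Real.log (Real.cosh l)) (Real.tanh (v 2)) (v 2) := by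
    rw [Real.tanh_eq_sinh_div_cosh]
    exact (Real.hasDerivAt_cosh _).log (Real.cosh_pos _).ne'
  have h2 := h1.comp_hasFDerivAt v (hasFDerivAt_coord 2 v)
  have h3 := (hasDerivAt_normMoment 0 (v 2)).comp_hasFDerivAt v (hasFDerivAt_coord 2 v)
  have h4 := ((hasFDerivAt_coord 0 v).pow 2).add ((hasFDerivAt_coord 1 v).pow 2)
  refine (h2.add (h4.mul h3)).congr_fderiv ?_
  ext w
  simp [heatExponentDeriv]
  ring

theorem hasTemperateGrowth_coord (i : Fin 3) :
    (fun v : Freq => v i).HasTemperateGrowth :=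
  (EuclideanSpace.proj (𝕜 := ℝ) i : Freq →L[ℝ] ℝ).hasTemperateGrowth

theorem hasTemperateGrowth_normMoment (j : ℕ) :
    (fun v : Freq => normMoment j (v 2)).HasTemperateGrowth :=
  (BddDeriv.hasTemperateGrowth fun n => bddDeriv_normMoment n j).comp (hasTemperateGrowth_coord 2)

theorem hasTemperateGrowth_tanh : (fun v : Freq => Real.tanh (v 2)).HasTemperateGrowth :=
  (BddDeriv.hasTemperateGrowth bddDeriv_tanh).comp (hasTemperateGrowth_coord 2)

theorem hasTemperateGrowth_heatExponentDeriv : heatExponentDeriv.HasTemperateGrowth := by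
  have h0 := hasTemperateGrowth_coord 0
  have h1 := hasTemperateGrowth_coord 1
  have m0 := hasTemperateGrowth_normMoment 0
  have m1 := hasTemperateGrowth_normMoment 1
  have t := hasTemperateGrowth_tanh
  have s0 : (fun v : Freq => v 0 ^ 2).HasTemperateGrowth := h0.pow 2
  have s1 : (fun v : Freq => v 1 ^ 2).HasTemperateGrowth := h1.pow 2
  unfold heatExponentDeriv
  fun_prop

theorem one_add_pow_mul_exp_neg_le (k : ℕ) {y : ℝ} (hy : 0 ≤ y) :
    (1 + y) ^ k * Real.exp (-y) ≤ k.factorial * Real.exp 1 := by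
  have h := Real.pow_div_factorial_le_exp (1 + y) (by positivity) k
  rw [div_le_iff₀ (by positivity)] at h
  calc (1 + y) ^ k * Real.exp (-y) ≤ (Real.exp (1 + y) * k.factorial) * Real.exp (-y) := by gcongr
    _ = k.factorial * (Real.exp (1 + y) * Real.exp (-y)) := by ring
    _ = k.factorial * Real.exp 1 := by rw [← Real.exp_add]; ring_nf

/-- Combines `cosh l ≥ exp |l| / 2` with `tanh l / l ≥ 1 / (1 + |l|)`. The decay in the horizontal
frequencies weakens as `|l|` grows, which the factor `exp (-|l|)` compensates. -/
theorem exp_neg_heatExponent_le (v : Freq) :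
    Real.exp (-heatExponent v) ≤
      2 * Real.exp (-|v 2|) * Real.exp (-((v 0 ^ 2 + v 1 ^ 2) / (1 + |v 2|))) := by
  have hc := Real.cosh_pos (v 2)
  have h1 : Real.exp |v 2| ≤ 2 * Real.cosh (v 2) := by
    rw [← Real.cosh_abs, Real.cosh_eq]; linarith [Real.exp_pos (-|v 2|)]
  rw [heatExponent, neg_add, Real.exp_add, Real.exp_neg, Real.exp_log hc]
  gcongr
  · rw [Real.exp_neg, inv_le_iff_one_le_mul₀ hc]
    have : 0 < Real.exp |v 2| := Real.exp_pos _
    calc (1 : ℝ) = (Real.exp |v 2|)⁻¹ * Real.exp |v 2| := (inv_mul_cancel₀ this.ne').symm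
      _ ≤ (Real.exp |v 2|)⁻¹ * (2 * Real.cosh (v 2)) := by gcongr
      _ = _ := by ring
  · have := inv_le_normMoment_zero (v 2)
    calc (v 0 ^ 2 + v 1 ^ 2) / (1 + |v 2|) = (v 0 ^ 2 + v 1 ^ 2) * (1 / (1 + |v 2|)) := by ring
      _ ≤ _ := by gcongr

theorem heatExponent_decay (k : ℕ) :
    ∃ C, ∀ v : Freq, (1 + ‖v‖) ^ k * Real.exp (-heatExponent v) ≤ C := by
  refine ⟨2 ^ k * 2 * ((2 * k).factorial * Real.exp 1) * (k.factorial * Real.exp 1), fun v => ?_⟩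
  set a := |v 2| with ha
  set y := (v 0 ^ 2 + v 1 ^ 2) / (1 + a) with hy
  have ha0 : 0 ≤ a := abs_nonneg _
  have hy0 : 0 ≤ y := by positivity
  have hn : ‖v‖ ^ 2 = v 0 ^ 2 + v 1 ^ 2 + a ^ 2 := by
    rw [EuclideanSpace.real_norm_sq_eq, Fin.sum_univ_three, ha, sq_abs]
  have hya : y * (1 + a) = v 0 ^ 2 + v 1 ^ 2 := by rw [hy]; field_simp
  -- Here `‖v‖ ^ 2 = y * (1 + a) + a ^ 2`, so the weight splits into a factor absorbed by `exp (-a)`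
  -- and one absorbed by `exp (-y)`.
  have h1 : 1 + ‖v‖ ≤ 2 * (1 + a) ^ 2 * (1 + y) := by
    nlinarith [sq_nonneg (‖v‖ - 1), mul_nonneg ha0 hy0, mul_nonneg (mul_nonneg ha0 ha0) hy0]
  have h2 : (1 + ‖v‖) ^ k ≤ 2 ^ k * (1 + a) ^ (2 * k) * (1 + y) ^ k := by
    calc (1 + ‖v‖) ^ k ≤ (2 * (1 + a) ^ 2 * (1 + y)) ^ k := by gcongr
      _ = _ := by rw [mul_pow, mul_pow, ← pow_mul]
  calc (1 + ‖v‖) ^ k * Real.exp (-heatExponent v)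
      ≤ (2 ^ k * (1 + a) ^ (2 * k) * (1 + y) ^ k) * (2 * Real.exp (-a) * Real.exp (-y)) := by
        gcongr; exact exp_neg_heatExponent_le v
    _ = 2 ^ k * 2 * ((1 + a) ^ (2 * k) * Real.exp (-a)) * ((1 + y) ^ k * Real.exp (-y)) := by ring
    _ ≤ _ := by
        refine mul_le_mul (mul_le_mul_of_nonneg_left ?_ (by positivity)) ?_ (by positivity)
          (by positivity)
        · exact one_add_pow_mul_exp_neg_le _ ha0
        · exact one_add_pow_mul_exp_neg_le _ hy0

theorem exists_heatSymbol : ∃ Φ : 𝓢(Freq, ℂ), ∀ v, Φ v = (Real.exp (-heatExponent v) : ℝ) := by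
  obtain ⟨Φ, hΦ⟩ := exists_schwartzMap_exp_neg (Q := heatExponent)
    (fun v => (hasFDerivAt_heatExponent v).differentiableAt)
    (by
      rw [show fderiv ℝ heatExponent = heatExponentDeriv from
        funext fun v => (hasFDerivAt_heatExponent v).fderiv]
      exact hasTemperateGrowth_heatExponentDeriv)
    heatExponent_decay
  exact ⟨SchwartzMap.postcompCLM (𝕜 := ℝ) Complex.ofRealCLM Φ, fun v => by
    simp [hΦ]⟩

/-- The Fourier transform of the heat kernel at time one. -/
noncomputable def heatSymbol : 𝓢(Freq, ℂ) := exists_heatSymbol.choose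

theorem heatSymbol_apply (v : Freq) : heatSymbol v = (Real.exp (-heatExponent v) : ℝ) :=
  exists_heatSymbol.choose_spec v

/-! ### Coordinate operators and the equation satisfied by the symbol. -/

/-- Multiplication of Schwartz functions by a coordinate. -/
noncomputable def coordMul (i : Fin 3) : 𝓢(Freq, ℂ) →L[ℝ] 𝓢(Freq, ℂ) :=
  SchwartzMap.smulLeftCLM ℂ fun v : Freq => v i

theorem coordMul_apply (i : Fin 3) (f : 𝓢(Freq, ℂ)) (v : Freq) :
    coordMul i f v = v i * f v := by
  rw [coordMul, SchwartzMap.smulLeftCLM_apply_apply (hasTemperateGrowth_coord i)]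
  simp

/-- The coordinate derivatives on Schwartz functions. -/
noncomputable def coordDeriv (i : Fin 3) (f : 𝓢(Freq, ℂ)) : 𝓢(Freq, ℂ) :=
  ∂_{(EuclideanSpace.single i (1 : ℝ) : Freq)} f

theorem coordDeriv_apply (i : Fin 3) (f : 𝓢(Freq, ℂ)) (v : Freq) :
    coordDeriv i f v = fderiv ℝ f v (EuclideanSpace.single i 1) :=
  SchwartzMap.lineDerivOp_apply_eq_fderiv _ _ _

theorem inner_single (i : Fin 3) :
    (fun v : Freq => inner ℝ v (EuclideanSpace.single i (1 : ℝ))) = fun v => v i := by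
  funext v; simp [EuclideanSpace.inner_single_right]

theorem coordDeriv_fourier (i : Fin 3) (f : 𝓢(Freq, ℂ)) :
    coordDeriv i (𝓕 f) = 𝓕 (-(2 * Real.pi * Complex.I) • coordMul i f) := by
  rw [coordDeriv, SchwartzMap.lineDerivOp_fourier_eq, inner_single]; rfl

theorem coordMul_fourier (i : Fin 3) (f : 𝓢(Freq, ℂ)) :
    coordMul i (𝓕 f) = 𝓕 ((2 * Real.pi * Complex.I)⁻¹ • coordDeriv i f) := by
  have h := SchwartzMap.fourier_lineDerivOp_eq f (EuclideanSpace.single i (1 : ℝ) : Freq)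
  rw [inner_single] at h
  rw [FourierSMul.fourier_smul, coordDeriv, h, smul_smul, inv_mul_cancel₀, one_smul]; rfl
  simp [Real.pi_ne_zero]

theorem fderiv_coord_mul {g : Freq → ℝ} {g' : Freq →L[ℝ] ℝ} {v : Freq} (hg : HasFDerivAt g g' v)
    (f : 𝓢(Freq, ℂ)) (w : Freq) :
    fderiv ℝ (fun v => (g v : ℂ) * f v) v w = g v * fderiv ℝ f v w + g' w * f v := by
  have h := hg.smul (f.hasFDerivAt v)
  have h2 : (fun v => (g v : ℂ) * f v) = fun v => g v • f v := by
    funext v; simp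
  rw [h2, show (fun v => g v • f v) = g • ⇑f from rfl, h.fderiv]
  simp

theorem coordDeriv_coordMul (i j : Fin 3) (f : 𝓢(Freq, ℂ)) :
    coordDeriv i (coordMul j f) = coordMul j (coordDeriv i f) + (if i = j then f else 0) := by
  ext v
  have h : (coordMul j f : Freq → ℂ) = fun v => ((v j : ℝ) : ℂ) * f v :=
    funext fun v => coordMul_apply j f v
  rw [coordDeriv_apply, h, fderiv_coord_mul (hasFDerivAt_coord j v), add_apply,
    coordMul_apply, coordDeriv_apply]
  congr 1
  by_cases hij : i = j
  · subst hij; simp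
  · simp [hij, Ne.symm hij]

theorem coordDeriv_heatSymbol (i : Fin 3) (v : Freq) :
    coordDeriv i heatSymbol v =
      -(heatExponentDeriv v (EuclideanSpace.single i 1) : ℝ) * heatSymbol v := by
  have h1 := (hasFDerivAt_heatExponent v).neg.exp
  have h2 := Complex.ofRealCLM.hasFDerivAt.comp v h1
  have h3 : (heatSymbol : Freq → ℂ) = Complex.ofRealCLM ∘ fun v => Real.exp (-heatExponent v) :=
    funext heatSymbol_apply
  rw [coordDeriv_apply, h3]
  refine (congrArg (fun A : Freq →L[ℝ] ℂ => A (EuclideanSpace.single i 1)) h2.fderiv).trans ?_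
  simp
  ring

/-- Multiplication by `tanh l / l`. -/
noncomputable def tanhMul : 𝓢(Freq, ℂ) →L[ℝ] 𝓢(Freq, ℂ) :=
  SchwartzMap.smulLeftCLM ℂ fun v : Freq => normMoment 0 (v 2)

theorem tanhMul_apply (f : 𝓢(Freq, ℂ)) (v : Freq) :
    tanhMul f v = normMoment 0 (v 2) * f v := by
  rw [tanhMul, SchwartzMap.smulLeftCLM_apply_apply (hasTemperateGrowth_normMoment 0)]
  simp

theorem coordDeriv_tanhMul {i : Fin 3} (hi : i ≠ 2) (f : 𝓢(Freq, ℂ)) :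
    coordDeriv i (tanhMul f) = tanhMul (coordDeriv i f) := by
  ext v
  have h : (tanhMul f : Freq → ℂ) = fun v => ((normMoment 0 (v 2) : ℝ) : ℂ) * f v :=
    funext fun v => tanhMul_apply f v
  have hd := (hasDerivAt_normMoment 0 (v 2)).comp_hasFDerivAt v (hasFDerivAt_coord 2 v)
  change HasFDerivAt (fun v : Freq => normMoment 0 (v 2)) _ v at hd
  rw [coordDeriv_apply, h, fderiv_coord_mul hd, tanhMul_apply, coordDeriv_apply]
  simp [Ne.symm hi]

theorem coordDeriv_heatSymbol_of_ne {i : Fin 3} (hi : i ≠ 2) :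
    coordDeriv i heatSymbol = (-2 : ℝ) • coordMul i (tanhMul heatSymbol) := by
  ext v
  rw [coordDeriv_heatSymbol, smul_apply, coordMul_apply, tanhMul_apply]
  fin_cases i
  · simp [heatExponentDeriv]; ring
  · simp [heatExponentDeriv]; ring
  · simp at hi

theorem coordDeriv_coordDeriv_heatSymbol {i : Fin 3} (hi : i ≠ 2) (v : Freq) :
    coordDeriv i (coordDeriv i heatSymbol) v =
      (4 * v i ^ 2 * normMoment 0 (v 2) ^ 2 - 2 * normMoment 0 (v 2) : ℝ) * heatSymbol v := by
  have hs : ∀ (c : ℝ) (f : 𝓢(Freq, ℂ)), coordDeriv i (c • f) = c • coordDeriv i f :=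
    fun c f => LineDeriv.lineDerivOp_smul _ c f
  rw [coordDeriv_heatSymbol_of_ne hi, hs, coordDeriv_coordMul, coordDeriv_tanhMul hi,
    coordDeriv_heatSymbol_of_ne hi]
  simp only [map_smul, if_true, smul_apply, add_apply, coordMul_apply,
    tanhMul_apply]
  simp
  ring

/-- The dilation equation for the heat symbol. -/
theorem heatSymbol_equation (v : Freq) :
    (v 0 * coordDeriv 0 heatSymbol v + v 1 * coordDeriv 1 heatSymbol v
        + 2 * v 2 * coordDeriv 2 heatSymbol v) / 2 =
      -(v 0 ^ 2 + v 1 ^ 2) * heatSymbol v + v 2 ^ 2 / 4 *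
        (coordDeriv 0 (coordDeriv 0 heatSymbol) v + coordDeriv 1 (coordDeriv 1 heatSymbol) v) := by
  rw [coordDeriv_coordDeriv_heatSymbol (by decide), coordDeriv_coordDeriv_heatSymbol (by decide),
    coordDeriv_heatSymbol, coordDeriv_heatSymbol, coordDeriv_heatSymbol]
  have h0 := mul_normMoment_zero (v 2)
  have h1 := mul_normMoment_one (v 2)
  -- After division by the symbol, with `l = v 2` and `m j = normMoment j l`, everything reduces to
  -- `l * m 0 = tanh l` and `l * m 1 = 1 - m 0`.
  have key : -(v 0 * (heatExponentDeriv v (EuclideanSpace.single 0 1)) +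
      v 1 * (heatExponentDeriv v (EuclideanSpace.single 1 1)) +
      2 * v 2 * (heatExponentDeriv v (EuclideanSpace.single 2 1))) / 2 =
      -(v 0 ^ 2 + v 1 ^ 2) + v 2 ^ 2 / 4 *
       ((4 * v 0 ^ 2 * normMoment 0 (v 2) ^ 2 - 2 * normMoment 0 (v 2)) +
        (4 * v 1 ^ 2 * normMoment 0 (v 2) ^ 2 - 2 * normMoment 0 (v 2))) := by
    simp [heatExponentDeriv]
    rw [← h0]
    linear_combination (-(v 0 ^ 2 + v 1 ^ 2)) * h1
  have key' := congrArg (fun r : ℝ => (r : ℂ) * heatSymbol v) key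
  simp only at key'
  push_cast at key' ⊢
  linear_combination key'

theorem coordMul_complex_smul (i : Fin 3) (c : ℂ) (f : 𝓢(Freq, ℂ)) :
    coordMul i (c • f) = c • coordMul i f := by
  ext v; simp only [coordMul_apply, smul_apply, smul_eq_mul]; ring

theorem coordDeriv_complex_smul (i : Fin 3) (c : ℂ) (f : 𝓢(Freq, ℂ)) :
    coordDeriv i (c • f) = c • coordDeriv i f :=
  LineDeriv.lineDerivOp_smul _ c f

theorem coordDeriv_real_smul (i : Fin 3) (c : ℝ) (f : 𝓢(Freq, ℂ)) :
    coordDeriv i (c • f) = c • coordDeriv i f :=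
  LineDeriv.lineDerivOp_smul _ c f

/-! ### Transfer of the equation to the kernel by Fourier transform. -/

/-- The complex valued heat kernel at time one in rescaled coordinates. -/
noncomputable def kernelFreq : 𝓢(Freq, ℂ) := 𝓕 heatSymbol

theorem two_pi_I_ne_zero : (2 * Real.pi * Complex.I : ℂ) ≠ 0 := by simp [Real.pi_ne_zero]

theorem two_pi_I_mul_self :
    (2 * Real.pi * Complex.I : ℂ) * (2 * Real.pi * Complex.I) = -(4 * Real.pi ^ 2) := by
  linear_combination (4 * (Real.pi : ℂ) ^ 2) * Complex.I_mul_I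

theorem coordDeriv_coordDeriv_kernelFreq (i j : Fin 3) :
    coordDeriv i (coordDeriv j kernelFreq) =
      𝓕 ((-(4 * Real.pi ^ 2) : ℂ) • coordMul i (coordMul j heatSymbol)) := by
  rw [kernelFreq, coordDeriv_fourier, coordDeriv_fourier, coordMul_complex_smul, smul_smul,
    neg_mul_neg, two_pi_I_mul_self]

theorem coordMul_coordMul_fourier (i j : Fin 3) (f : 𝓢(Freq, ℂ)) :
    coordMul i (coordMul j (𝓕 f)) =
      𝓕 ((-(4 * Real.pi ^ 2) : ℂ)⁻¹ • coordDeriv i (coordDeriv j f)) := by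
  rw [coordMul_fourier, coordMul_fourier, coordDeriv_complex_smul, smul_smul, ← mul_inv,
    two_pi_I_mul_self]

theorem neg_four_pi_sq_ne_zero : (-(4 * Real.pi ^ 2) : ℂ) ≠ 0 := by simp [Real.pi_ne_zero]

theorem coordMul_coordMul_coordDeriv_coordDeriv_kernelFreq (i j : Fin 3) :
    coordMul i (coordMul i (coordDeriv j (coordDeriv j kernelFreq))) =
      𝓕 (coordDeriv i (coordDeriv i (coordMul j (coordMul j heatSymbol)))) := by
  rw [coordDeriv_coordDeriv_kernelFreq, coordMul_coordMul_fourier, coordDeriv_complex_smul,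
    coordDeriv_complex_smul, smul_smul, inv_mul_cancel₀ neg_four_pi_sq_ne_zero, one_smul]

theorem coordMul_coordDeriv_coordDeriv_kernelFreq (i j k : Fin 3) :
    coordMul i (coordDeriv j (coordDeriv k kernelFreq)) =
      𝓕 ((2 * Real.pi * Complex.I : ℂ) • coordDeriv i (coordMul j (coordMul k heatSymbol))) := by
  rw [coordDeriv_coordDeriv_kernelFreq, coordMul_fourier, coordDeriv_complex_smul, smul_smul,
    ← two_pi_I_mul_self, inv_mul_cancel_left₀ two_pi_I_ne_zero]

theorem coordMul_coordDeriv_kernelFreq (i : Fin 3) :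
    coordMul i (coordDeriv i kernelFreq) = 𝓕 ((-1 : ℂ) • coordDeriv i (coordMul i heatSymbol)) := by
  rw [kernelFreq, coordDeriv_fourier, coordMul_fourier, coordDeriv_complex_smul, smul_smul,
    mul_neg, inv_mul_cancel₀ two_pi_I_ne_zero]

theorem coordDeriv_coordMul_of_ne {i j : Fin 3} (h : i ≠ j) (f : 𝓢(Freq, ℂ)) :
    coordDeriv i (coordMul j f) = coordMul j (coordDeriv i f) := by
  rw [coordDeriv_coordMul, if_neg h, add_zero]

theorem coordDeriv_coordMul_self (i : Fin 3) (f : 𝓢(Freq, ℂ)) :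
    coordDeriv i (coordMul i f) = coordMul i (coordDeriv i f) + f := by
  rw [coordDeriv_coordMul, if_pos rfl]

/-- The Fourier transform exchanges derivatives and multiplications, so this is
`heatSymbol_equation` transformed. The powers of `2π` come from the convention `exp (-2πi⟨·,·⟩)` and
disappear under the rescaling `toFreq`; the final coefficient `2` is half the homogeneous dimension
`4`. -/
theorem kernelFreq_equation_schwartz :
    (4 * Real.pi ^ 2 : ℂ)⁻¹ • (coordDeriv 0 (coordDeriv 0 kernelFreq) +
        coordDeriv 1 (coordDeriv 1 kernelFreq)) +
      (1 / 4 : ℂ) • (coordMul 0 (coordMul 0 (coordDeriv 2 (coordDeriv 2 kernelFreq))) +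
        coordMul 1 (coordMul 1 (coordDeriv 2 (coordDeriv 2 kernelFreq)))) +
      (2 * Real.pi : ℂ)⁻¹ • (coordMul 0 (coordDeriv 1 (coordDeriv 2 kernelFreq)) -
        coordMul 1 (coordDeriv 0 (coordDeriv 2 kernelFreq))) +
      (1 / 2 : ℂ) • (coordMul 0 (coordDeriv 0 kernelFreq) + coordMul 1 (coordDeriv 1 kernelFreq) +
        (2 : ℂ) • coordMul 2 (coordDeriv 2 kernelFreq)) + (2 : ℂ) • kernelFreq = 0 := by
  rw [coordMul_coordMul_coordDeriv_coordDeriv_kernelFreq,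
    coordMul_coordMul_coordDeriv_coordDeriv_kernelFreq,
    coordMul_coordDeriv_coordDeriv_kernelFreq, coordMul_coordDeriv_coordDeriv_kernelFreq,
    coordDeriv_coordDeriv_kernelFreq, coordDeriv_coordDeriv_kernelFreq,
    coordMul_coordDeriv_kernelFreq, coordMul_coordDeriv_kernelFreq, coordMul_coordDeriv_kernelFreq,
    kernelFreq]
  simp only [← FourierTransform.fourierCLM_apply (R := ℂ), ← map_smul, ← map_add, ← map_sub]
  rw [← map_zero (FourierTransform.fourierCLM ℂ 𝓢(Freq, ℂ))]
  congr 1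
  ext v
  have h := heatSymbol_equation v
  -- The symbol is radial in the first two frequencies, so the rotation field `x∂_y - y∂_x` in `L`
  -- contributes nothing.
  have hrot : (v 0 : ℂ) * coordDeriv 1 heatSymbol v = v 1 * coordDeriv 0 heatSymbol v := by
    rw [coordDeriv_heatSymbol, coordDeriv_heatSymbol]
    simp [heatExponentDeriv]
    ring
  have hpi : (Real.pi : ℂ) ≠ 0 := by simp [Real.pi_ne_zero]
  simp only [coordDeriv_coordMul_of_ne (show (0 : Fin 3) ≠ 1 by decide),
    coordDeriv_coordMul_of_ne (show (0 : Fin 3) ≠ 2 by decide),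
    coordDeriv_coordMul_of_ne (show (1 : Fin 3) ≠ 0 by decide),
    coordDeriv_coordMul_of_ne (show (1 : Fin 3) ≠ 2 by decide),
    coordDeriv_coordMul_self, add_apply, sub_apply, smul_apply, coordMul_apply, smul_eq_mul,
    zero_apply]
  field_simp
  linear_combination (-8) * h - 8 * Complex.I * v 2 * hrot

/-! ### Group coordinates, rotation invariance and normalization of the kernel. -/

/-- Rescaled identification of the group with the frequency space. -/
noncomputable def toFreq : Point ≃L[ℝ] Freq :=
  LinearEquiv.toContinuousLinearEquiv
    { toFun := fun p => (2 * Real.pi)⁻¹ • !₂[p.1, p.2.1, p.2.2]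
      invFun := fun v => (2 * Real.pi * v 0, 2 * Real.pi * v 1, 2 * Real.pi * v 2)
      map_add' := fun p q => by
        ext i; fin_cases i <;> simp <;> ring
      map_smul' := fun c p => by
        ext i; fin_cases i <;> simp <;> ring
      left_inv := fun p => by
        have := Real.pi_ne_zero
        ext <;> simp <;> field_simp
      right_inv := fun v => by
        have := Real.pi_ne_zero
        ext i; fin_cases i <;> simp <;> field_simp }

theorem toFreq_apply (p : Point) : toFreq p = (2 * Real.pi)⁻¹ • !₂[p.1, p.2.1, p.2.2] := rfl

theorem toFreq_coord (p : Point) : p.1 = 2 * Real.pi * toFreq p 0 ∧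
    p.2.1 = 2 * Real.pi * toFreq p 1 ∧ p.2.2 = 2 * Real.pi * toFreq p 2 := by
  have := Real.pi_ne_zero
  simp only [toFreq_apply]
  refine ⟨?_, ?_, ?_⟩ <;> simp <;> field_simp

/-- The standard basis of the group coordinates. -/
noncomputable def basisVec : Fin 3 → Point := ![(1, 0, 0), (0, 1, 0), (0, 0, 1)]

theorem toFreq_basisVec (i : Fin 3) :
    toFreq (basisVec i) = (2 * Real.pi)⁻¹ • EuclideanSpace.single i (1 : ℝ) := by
  rw [toFreq_apply]
  congr 1
  ext j
  fin_cases i <;> fin_cases j <;> simp [basisVec]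

theorem lineDeriv_comp_toFreq (i : Fin 3) (f : 𝓢(Freq, ℂ)) :
    ∂_{basisVec i} (SchwartzMap.compCLMOfContinuousLinearEquiv ℝ toFreq f) =
      SchwartzMap.compCLMOfContinuousLinearEquiv ℝ toFreq ((2 * Real.pi)⁻¹ • coordDeriv i f) := by
  rw [SchwartzMap.lineDerivOp_compCLMOfContinuousLinearEquiv, toFreq_basisVec,
    LineDeriv.lineDerivOp_left_smul]
  rfl

theorem lineDeriv_re {E : Type*} [NormedAddCommGroup E] [NormedSpace ℝ E] (m : E) (f : 𝓢(E, ℂ)) :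
    ∂_{m} (SchwartzMap.postcompCLM Complex.reCLM f) =
      SchwartzMap.postcompCLM Complex.reCLM (∂_{m} f) := by
  ext p
  have h := Complex.reCLM.hasFDerivAt.comp p (f.hasFDerivAt p)
  rw [SchwartzMap.lineDerivOp_apply_eq_fderiv, SchwartzMap.postcompCLM_apply,
    SchwartzMap.lineDerivOp_apply_eq_fderiv]
  exact congrArg (fun A : E →L[ℝ] ℝ => A m) h.fderiv

/-- The heat kernel at time one up to normalization. -/
noncomputable def preKernel : 𝓢(Point, ℝ) :=
  SchwartzMap.postcompCLM Complex.reCLM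
    (SchwartzMap.compCLMOfContinuousLinearEquiv ℝ toFreq kernelFreq)

theorem preKernel_apply (p : Point) : preKernel p = (kernelFreq (toFreq p)).re := rfl

theorem lineDeriv_preKernel (i : Fin 3) (p : Point) :
    (∂_{basisVec i} preKernel : 𝓢(Point, ℝ)) p =
      (2 * Real.pi)⁻¹ * (coordDeriv i kernelFreq (toFreq p)).re := by
  rw [preKernel, lineDeriv_re, lineDeriv_comp_toFreq, SchwartzMap.postcompCLM_apply,
    SchwartzMap.compCLMOfContinuousLinearEquiv_apply, Function.comp_apply, smul_apply]
  simp

theorem lineDeriv_lineDeriv_preKernel (i j : Fin 3) (p : Point) :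
    (∂_{basisVec i} (∂_{basisVec j} preKernel) : 𝓢(Point, ℝ)) p =
      (2 * Real.pi)⁻¹ * ((2 * Real.pi)⁻¹ * (coordDeriv i (coordDeriv j kernelFreq) (toFreq p)).re) := by
  rw [preKernel, lineDeriv_re, lineDeriv_comp_toFreq, lineDeriv_re, lineDeriv_comp_toFreq,
    SchwartzMap.postcompCLM_apply, SchwartzMap.compCLMOfContinuousLinearEquiv_apply,
    Function.comp_apply, coordDeriv_real_smul, smul_apply, smul_apply]
  simp

/-- The coefficients are real, so the equation passes to the real part; no proof that the kernel is
real valued is required. -/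
theorem preKernel_equation (p : Point) :
    (∂_{basisVec 0} (∂_{basisVec 0} preKernel) : 𝓢(Point, ℝ)) p +
      (∂_{basisVec 1} (∂_{basisVec 1} preKernel) : 𝓢(Point, ℝ)) p +
      (p.1 ^ 2 + p.2.1 ^ 2) / 4 * (∂_{basisVec 2} (∂_{basisVec 2} preKernel) : 𝓢(Point, ℝ)) p +
      (p.1 * (∂_{basisVec 1} (∂_{basisVec 2} preKernel) : 𝓢(Point, ℝ)) p -
        p.2.1 * (∂_{basisVec 0} (∂_{basisVec 2} preKernel) : 𝓢(Point, ℝ)) p) +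
      (p.1 * (∂_{basisVec 0} preKernel : 𝓢(Point, ℝ)) p +
        p.2.1 * (∂_{basisVec 1} preKernel : 𝓢(Point, ℝ)) p +
        2 * p.2.2 * (∂_{basisVec 2} preKernel : 𝓢(Point, ℝ)) p) / 2 + 2 * preKernel p = 0 := by
  have h := congrArg (fun f : 𝓢(Freq, ℂ) => (f (toFreq p)).re) kernelFreq_equation_schwartz
  obtain ⟨hx, hy, hz⟩ := toFreq_coord p
  have hpi := Real.pi_ne_zero
  simp only [add_apply, sub_apply, smul_apply, coordMul_apply, smul_eq_mul, zero_apply] at h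
  simp only [lineDeriv_preKernel, lineDeriv_lineDeriv_preKernel, preKernel_apply]
  have e1 : (4 * Real.pi ^ 2 : ℂ)⁻¹ = ((4 * Real.pi ^ 2)⁻¹ : ℝ) := by push_cast; rfl
  have e2 : (2 * Real.pi : ℂ)⁻¹ = ((2 * Real.pi)⁻¹ : ℝ) := by push_cast; rfl
  have e3 : (1 / 4 : ℂ) = (1 / 4 : ℝ) := by push_cast; rfl
  have e4 : (1 / 2 : ℂ) = (1 / 2 : ℝ) := by push_cast; rfl
  have e5 : (2 : ℂ) = (2 : ℝ) := by push_cast; rfl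
  rw [e1, e2, e3, e4, e5] at h
  simp only [Complex.add_re, Complex.sub_re, Complex.re_ofReal_mul, Complex.zero_re] at h
  rw [← h, hx, hy, hz]
  field_simp
  ring

/-- Rotation by a quarter turn around the last axis. -/
noncomputable def quarterTurn : Freq ≃ₗᵢ[ℝ] Freq where
  toFun v := !₂[-v 1, v 0, v 2]
  invFun v := !₂[v 1, -v 0, v 2]
  map_add' v w := by ext i; fin_cases i <;> simp; ring
  map_smul' c v := by ext i; fin_cases i <;> simp
  left_inv v := by ext i; fin_cases i <;> simp
  right_inv v := by ext i; fin_cases i <;> simp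
  norm_map' v := by
    rw [EuclideanSpace.norm_eq, EuclideanSpace.norm_eq]
    simp [Fin.sum_univ_three]
    ring_nf

theorem quarterTurn_apply (v : Freq) : quarterTurn v = !₂[-v 1, v 0, v 2] := rfl

theorem preKernel_rot (x y z : ℝ) : preKernel (-y, x, z) = preKernel (x, y, z) := by
  have h1 : (heatSymbol : Freq → ℂ) ∘ quarterTurn = heatSymbol := by
    funext v
    simp only [Function.comp_apply, heatSymbol_apply, heatExponent, quarterTurn_apply]
    simp [add_comm]
  have h2 : toFreq (-y, x, z) = quarterTurn (toFreq (x, y, z)) := by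
    rw [quarterTurn_apply, toFreq_apply, toFreq_apply]
    ext i; fin_cases i <;> simp
  have h3 := Real.fourier_comp_linearIsometry quarterTurn (heatSymbol : Freq → ℂ) (toFreq (x, y, z))
  rw [h1] at h3
  rw [preKernel_apply, preKernel_apply, h2, kernelFreq, SchwartzMap.fourier_coe, ← h3]

theorem integral_kernelFreq : ∫ v, kernelFreq v = 1 := by
  have h1 : (𝓕⁻ (𝓕 heatSymbol) : 𝓢(Freq, ℂ)) = heatSymbol := FourierTransform.fourierInv_fourier_eq _
  have h2 := congrArg (fun f : 𝓢(Freq, ℂ) => f 0) h1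
  simp only [SchwartzMap.fourierInv_coe, heatSymbol_apply] at h2
  rw [Real.fourierInv_eq] at h2
  simpa [heatExponent, kernelFreq] using h2

instance isAddHaarMeasure_volume : (volume : Measure Point).IsAddHaarMeasure :=
  have : (volume : Measure (ℝ × ℝ)).IsAddHaarMeasure := Measure.prod.instIsAddHaarMeasure _ _
  Measure.prod.instIsAddHaarMeasure _ _

/-- Fourier inversion at zero gives mass one in frequency coordinates, and `toFreq` carries Lebesgue
measure to a positive multiple of itself. The multiple need not be computed, because the kernel is
divided by its integral afterwards. -/
theorem exists_integral_preKernel_ne_zero : ∃ c : ℝ, c ≠ 0 ∧ ∫ p, preKernel p = c := by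
  refine ⟨_, ?_, rfl⟩
  have hm : (volume.map toFreq : Measure Freq).IsAddHaarMeasure :=
    toFreq.isAddHaarMeasure_map volume
  have hmap := Measure.isAddLeftInvariant_eq_smul (volume.map toFreq : Measure Freq) volume
  have hc0 := Measure.addHaarScalarFactor_pos_of_isAddHaarMeasure
    (volume.map toFreq : Measure Freq) volume
  set c := Measure.addHaarScalarFactor (volume.map toFreq : Measure Freq) volume
  have h1 : ∫ p, preKernel p = (∫ p, kernelFreq (toFreq p)).re := by
    simp only [preKernel_apply]
    exact integral_re (SchwartzMap.integrable
      (SchwartzMap.compCLMOfContinuousLinearEquiv ℝ toFreq kernelFreq))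
  have h2 : ∫ p, kernelFreq (toFreq p) = ∫ v, kernelFreq v ∂(volume.map toFreq) :=
    (toFreq.toHomeomorph.measurableEmbedding.integral_map _).symm
  rw [h1, h2, hmap, integral_smul_nnreal_measure, integral_kernelFreq]
  rw [NNReal.smul_def]
  simpa using hc0.ne'

/-- The heat kernel at time one. -/
theorem exists_heatKernel : ∃ h : 𝓢(Point, ℝ), ∫ p, h p = 1 ∧
    (∀ x y z, h (-y, x, z) = h (x, y, z)) ∧ ∀ p : Point,
    (∂_{basisVec 0} (∂_{basisVec 0} h) : 𝓢(Point, ℝ)) p +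
      (∂_{basisVec 1} (∂_{basisVec 1} h) : 𝓢(Point, ℝ)) p +
      (p.1 ^ 2 + p.2.1 ^ 2) / 4 * (∂_{basisVec 2} (∂_{basisVec 2} h) : 𝓢(Point, ℝ)) p +
      (p.1 * (∂_{basisVec 1} (∂_{basisVec 2} h) : 𝓢(Point, ℝ)) p -
        p.2.1 * (∂_{basisVec 0} (∂_{basisVec 2} h) : 𝓢(Point, ℝ)) p) +
      (p.1 * (∂_{basisVec 0} h : 𝓢(Point, ℝ)) p + p.2.1 * (∂_{basisVec 1} h : 𝓢(Point, ℝ)) p +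
        2 * p.2.2 * (∂_{basisVec 2} h : 𝓢(Point, ℝ)) p) / 2 + 2 * h p = 0 := by
  obtain ⟨c, hc, hint⟩ := exists_integral_preKernel_ne_zero
  refine ⟨c⁻¹ • preKernel, ?_, fun x y z => ?_, fun p => ?_⟩
  · simp only [smul_apply, smul_eq_mul]
    rw [integral_const_mul, hint, inv_mul_cancel₀ hc]
  · rw [smul_apply, smul_apply, preKernel_rot]
  · simp only [LineDeriv.lineDerivOp_smul, smul_apply, smul_eq_mul]
    linear_combination c⁻¹ * preKernel_equation p

/-! ### The vector fields as operators on Schwartz functions. -/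

theorem hasTemperateGrowth_fst : (fun p : Point => p.1).HasTemperateGrowth :=
  (ContinuousLinearMap.fst ℝ ℝ (ℝ × ℝ)).hasTemperateGrowth

theorem hasTemperateGrowth_snd_fst : (fun p : Point => p.2.1).HasTemperateGrowth :=
  ((ContinuousLinearMap.fst ℝ ℝ ℝ).comp (ContinuousLinearMap.snd ℝ ℝ (ℝ × ℝ))).hasTemperateGrowth

/-- The vector field `X` on Schwartz functions. -/
noncomputable def schwartzX (f : 𝓢(Point, ℝ)) : 𝓢(Point, ℝ) :=
  ∂_{basisVec 0} f - (1 / 2 : ℝ) • SchwartzMap.smulLeftCLM ℝ (fun p : Point => p.2.1) (∂_{basisVec 2} f)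

/-- The vector field `Y` on Schwartz functions. -/
noncomputable def schwartzY (f : 𝓢(Point, ℝ)) : 𝓢(Point, ℝ) :=
  ∂_{basisVec 1} f + (1 / 2 : ℝ) • SchwartzMap.smulLeftCLM ℝ (fun p : Point => p.1) (∂_{basisVec 2} f)

/-- The sub-Laplacian on Schwartz functions. -/
noncomputable def schwartzL (f : 𝓢(Point, ℝ)) : 𝓢(Point, ℝ) :=
  schwartzX (schwartzX f) + schwartzY (schwartzY f)

theorem lineDeriv_apply (i : Fin 3) (f : 𝓢(Point, ℝ)) (p : Point) :
    (∂_{basisVec i} f : 𝓢(Point, ℝ)) p = fderiv ℝ f p (basisVec i) :=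
  SchwartzMap.lineDerivOp_apply_eq_fderiv _ _ _

theorem schwartzX_apply (f : 𝓢(Point, ℝ)) (p : Point) :
    schwartzX f p = (∂_{basisVec 0} f : 𝓢(Point, ℝ)) p
      - p.2.1 / 2 * (∂_{basisVec 2} f : 𝓢(Point, ℝ)) p := by
  rw [schwartzX, sub_apply, smul_apply,
    SchwartzMap.smulLeftCLM_apply_apply hasTemperateGrowth_snd_fst]
  simp only [smul_eq_mul]; ring

theorem schwartzY_apply (f : 𝓢(Point, ℝ)) (p : Point) :
    schwartzY f p = (∂_{basisVec 1} f : 𝓢(Point, ℝ)) p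
      + p.1 / 2 * (∂_{basisVec 2} f : 𝓢(Point, ℝ)) p := by
  rw [schwartzY, add_apply, smul_apply,
    SchwartzMap.smulLeftCLM_apply_apply hasTemperateGrowth_fst]
  simp only [smul_eq_mul]; ring

theorem schwartzX_eq_fderiv (f : 𝓢(Point, ℝ)) (p : Point) :
    schwartzX f p = fderiv ℝ f p (1, 0, -p.2.1 / 2) := by
  have h : ((1, 0, -p.2.1 / 2) : Point) = basisVec 0 - (p.2.1 / 2) • basisVec 2 := by
    ext <;> simp [basisVec]; ring
  rw [schwartzX_apply, h, map_sub, map_smul, lineDeriv_apply, lineDeriv_apply, smul_eq_mul]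

theorem schwartzY_eq_fderiv (f : 𝓢(Point, ℝ)) (p : Point) :
    schwartzY f p = fderiv ℝ f p (0, 1, p.1 / 2) := by
  have h : ((0, 1, p.1 / 2) : Point) = basisVec 1 + (p.1 / 2) • basisVec 2 := by
    ext <;> simp [basisVec]
  rw [schwartzY_apply, h, map_add, map_smul, lineDeriv_apply, lineDeriv_apply, smul_eq_mul]

theorem hasDerivAt_flow_X (f : 𝓢(Point, ℝ)) (p : Point) (ε : ℝ) :
    HasDerivAt (fun ε : ℝ => f (mul p (ε, 0, 0))) (schwartzX f (mul p (ε, 0, 0))) ε := by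
  have h1 : HasDerivAt (fun ε : ℝ => mul p (ε, 0, 0)) ((1, 0, -p.2.1 / 2) : Point) ε := by
    unfold mul
    refine HasDerivAt.prodMk ?_ (HasDerivAt.prodMk ?_ ?_)
    · simpa using (hasDerivAt_id ε).const_add p.1
    · simpa using hasDerivAt_const ε p.2.1
    · have := (((hasDerivAt_id ε).const_mul p.2.1).const_sub (p.1 * 0)).div_const 2
      simpa using this.const_add (p.2.2 + 0)
  have h2 := (f.hasFDerivAt (mul p (ε, 0, 0))).comp_hasDerivAt ε h1
  rw [schwartzX_eq_fderiv]
  exact h2.congr_deriv (by simp [mul])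

theorem hasDerivAt_flow_Y (f : 𝓢(Point, ℝ)) (p : Point) (ε : ℝ) :
    HasDerivAt (fun ε : ℝ => f (mul p (0, ε, 0))) (schwartzY f (mul p (0, ε, 0))) ε := by
  have h1 : HasDerivAt (fun ε : ℝ => mul p (0, ε, 0)) ((0, 1, p.1 / 2) : Point) ε := by
    unfold mul
    refine HasDerivAt.prodMk ?_ (HasDerivAt.prodMk ?_ ?_)
    · simpa using hasDerivAt_const ε p.1
    · simpa using (hasDerivAt_id ε).const_add p.2.1
    · have := (((hasDerivAt_id ε).const_mul p.1).sub_const (p.2.1 * 0)).div_const 2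
      simpa using this.const_add (p.2.2 + 0)
  have h2 := (f.hasFDerivAt (mul p (0, ε, 0))).comp_hasDerivAt ε h1
  rw [schwartzY_eq_fderiv]
  exact h2.congr_deriv (by simp [mul])

theorem lineDeriv_comm (i j : Fin 3) (f : 𝓢(Point, ℝ)) :
    (∂_{basisVec i} (∂_{basisVec j} f) : 𝓢(Point, ℝ)) = ∂_{basisVec j} (∂_{basisVec i} f) := by
  have h : ∀ (i j : Fin 3) (p : Point), (∂_{basisVec i} (∂_{basisVec j} f) : 𝓢(Point, ℝ)) p =
      fderiv ℝ (fderiv ℝ f) p (basisVec i) (basisVec j) := by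
    intro i j p
    have hd : DifferentiableAt ℝ (fderiv ℝ f) p :=
      ((f.smooth ⊤).fderiv_right (m := 1) (by norm_cast)).differentiable (by norm_num) p
    have h1 : ((∂_{basisVec j} f : 𝓢(Point, ℝ)) : Point → ℝ) = fun q => fderiv ℝ f q (basisVec j) :=
      funext fun q => lineDeriv_apply j f q
    rw [lineDeriv_apply, h1, fderiv_clm_apply hd (by fun_prop)]
    simp
  ext p
  rw [h, h]
  exact ((f.smooth 2).contDiffAt.isSymmSndFDerivAt (by simp)).eq _ _

theorem lineDeriv_smulLeft {g : Point → ℝ} (hg : g.HasTemperateGrowth) (i : Fin 3)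
    (f : 𝓢(Point, ℝ)) (p : Point) :
    (∂_{basisVec i} (SchwartzMap.smulLeftCLM ℝ g f) : 𝓢(Point, ℝ)) p =
      g p * (∂_{basisVec i} f : 𝓢(Point, ℝ)) p + fderiv ℝ g p (basisVec i) * f p := by
  have h1 : (SchwartzMap.smulLeftCLM ℝ g f : Point → ℝ) = fun q => g q * f q :=
    funext fun q => by rw [SchwartzMap.smulLeftCLM_apply_apply hg]; rfl
  have hgd : DifferentiableAt ℝ g p := hg.1.differentiable (by norm_num) p
  rw [lineDeriv_apply, lineDeriv_apply, h1, fderiv_fun_mul hgd (f.hasFDerivAt p).differentiableAt]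
  simp [mul_comm]

theorem lineDeriv_sub' (i : Fin 3) (f g : 𝓢(Point, ℝ)) :
    (∂_{basisVec i} (f - g) : 𝓢(Point, ℝ)) = ∂_{basisVec i} f - ∂_{basisVec i} g := by
  rw [sub_eq_add_neg, LineDeriv.lineDerivOp_add, LineDeriv.lineDerivOp_neg, sub_eq_add_neg]

theorem schwartzL_apply (f : 𝓢(Point, ℝ)) (p : Point) :
    schwartzL f p = (∂_{basisVec 0} (∂_{basisVec 0} f) : 𝓢(Point, ℝ)) p +
      (∂_{basisVec 1} (∂_{basisVec 1} f) : 𝓢(Point, ℝ)) p +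
      (p.1 ^ 2 + p.2.1 ^ 2) / 4 * (∂_{basisVec 2} (∂_{basisVec 2} f) : 𝓢(Point, ℝ)) p +
      (p.1 * (∂_{basisVec 1} (∂_{basisVec 2} f) : 𝓢(Point, ℝ)) p -
        p.2.1 * (∂_{basisVec 0} (∂_{basisVec 2} f) : 𝓢(Point, ℝ)) p) := by
  have e1 : ∀ q : Point, fderiv ℝ (fun p : Point => p.1) q =
      ContinuousLinearMap.fst ℝ ℝ (ℝ × ℝ) := fun q =>
    (ContinuousLinearMap.fst ℝ ℝ (ℝ × ℝ)).fderiv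
  have e2 : ∀ q : Point, fderiv ℝ (fun p : Point => p.2.1) q =
      (ContinuousLinearMap.fst ℝ ℝ ℝ).comp (ContinuousLinearMap.snd ℝ ℝ (ℝ × ℝ)) := fun q =>
    ((ContinuousLinearMap.fst ℝ ℝ ℝ).comp (ContinuousLinearMap.snd ℝ ℝ (ℝ × ℝ))).fderiv
  rw [schwartzL, add_apply, schwartzX_apply, schwartzY_apply]
  simp only [schwartzX, schwartzY, lineDeriv_sub', LineDeriv.lineDerivOp_add,
    LineDeriv.lineDerivOp_smul, add_apply, sub_apply, smul_apply, smul_eq_mul,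
    lineDeriv_smulLeft hasTemperateGrowth_fst, lineDeriv_smulLeft hasTemperateGrowth_snd_fst, e1, e2,
    lineDeriv_comm 2 0, lineDeriv_comm 2 1]
  simp [basisVec]
  ring

/-- The heat kernel at time one. -/
noncomputable def heatKernel : 𝓢(Point, ℝ) := exists_heatKernel.choose

theorem integral_heatKernel : ∫ p, heatKernel p = 1 := exists_heatKernel.choose_spec.1

theorem heatKernel_rot (x y z : ℝ) : heatKernel (-y, x, z) = heatKernel (x, y, z) :=
  exists_heatKernel.choose_spec.2.1 x y z

/-- This is the heat equation for the self-similar family `t⁻² h ∘ δ_{1/√t}`, read at `t = 1`. -/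
theorem schwartzL_heatKernel (p : Point) :
    schwartzL heatKernel p =
      -(fderiv ℝ heatKernel p (p.1, p.2.1, 2 * p.2.2) + 4 * heatKernel p) / 2 := by
  have h := exists_heatKernel.choose_spec.2.2 p
  have e : ((p.1, p.2.1, 2 * p.2.2) : Point) =
      p.1 • basisVec 0 + p.2.1 • basisVec 1 + (2 * p.2.2) • basisVec 2 := by
    ext <;> simp [basisVec]
  rw [e, map_add, map_add, map_smul, map_smul, map_smul, ← lineDeriv_apply, ← lineDeriv_apply,
    ← lineDeriv_apply, schwartzL_apply]
  simp only [smul_eq_mul]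
  change _ at h
  rw [← heatKernel] at h
  linarith

theorem X_schwartz (f : 𝓢(Point, ℝ)) (p : Point) : X f p = schwartzX f p := by
  have := (hasDerivAt_flow_X f p 0).deriv
  rw [X, this]; simp [mul]

theorem Y_schwartz (f : 𝓢(Point, ℝ)) (p : Point) : Y f p = schwartzY f p := by
  have := (hasDerivAt_flow_Y f p 0).deriv
  rw [Y, this]; simp [mul]

/-! ### Averages against the dilated kernel solve the heat equation. -/

/-- The point `p (δ_s v)⁻¹`, where `δ_s` is the dilation. -/
noncomputable def act (s : ℝ) (p v : Point) : Point :=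
  (p.1 - s * v.1, p.2.1 - s * v.2.1,
    p.2.2 - s ^ 2 * v.2.2 + (p.2.1 * (s * v.1) - p.1 * (s * v.2.1)) / 2)

/-- The point `δ_{1/s} (q⁻¹ p)`. -/
noncomputable def rel (s : ℝ) (q p : Point) : Point :=
  ((p.1 - q.1) / s, (p.2.1 - q.2.1) / s,
    (p.2.2 - q.2.2 + (q.2.1 * p.1 - q.1 * p.2.1) / 2) / s ^ 2)

theorem act_rel {s : ℝ} (hs : s ≠ 0) (p q : Point) : act s p (rel s q p) = q := by
  simp only [act, rel]
  ext
  · field_simp; ring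
  · field_simp; ring
  · field_simp; ring

theorem rel_act {s : ℝ} (hs : s ≠ 0) (p v : Point) : rel s (act s p v) p = v := by
  simp only [act, rel]
  ext
  · field_simp; ring
  · field_simp; ring
  · field_simp; ring

theorem map_dilation {c : ℝ} (hc : 0 < c) :
    (volume : Measure Point).map (fun p => (c * p.1, c * p.2.1, c ^ 2 * p.2.2)) =
      ENNReal.ofReal ((c ^ 4)⁻¹) • volume := by
  have h : ∀ {a : ℝ}, 0 < a → (volume : Measure ℝ).map (a * ·) = ENNReal.ofReal a⁻¹ • volume := by
    intro a ha
    rw [Real.map_volume_mul_left ha.ne', abs_of_pos (inv_pos.2 ha)]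
  have e : (fun p : Point => (c * p.1, c * p.2.1, c ^ 2 * p.2.2)) =
      Prod.map (c * ·) (Prod.map (c * ·) (c ^ 2 * ·)) := rfl
  rw [e, Measure.volume_eq_prod, Measure.volume_eq_prod,
    ← Measure.map_prod_map _ _ (by fun_prop) (by fun_prop),
    ← Measure.map_prod_map _ _ (by fun_prop) (by fun_prop), h hc, h (by positivity)]
  simp only [Measure.prod_smul_left, Measure.prod_smul_right, smul_smul]
  rw [← ENNReal.ofReal_mul (by positivity), ← ENNReal.ofReal_mul (by positivity)]
  congr 2
  field_simp

/-- The map is triangular: each coordinate is reflected and then translated by an amount depending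
only on the preceding ones. -/
theorem measurePreserving_inv_mul (p : Point) :
    MeasurePreserving (fun q : Point => (p.1 - q.1, p.2.1 - q.2.1,
      p.2.2 - q.2.2 + (q.2.1 * p.1 - q.1 * p.2.1) / 2)) := by
  have h1 : ∀ x : ℝ, MeasurePreserving (fun w : ℝ × ℝ =>
      (p.2.1 - w.1, p.2.2 - w.2 + (w.1 * p.1 - x * p.2.1) / 2)) := fun x =>
    (Measure.measurePreserving_sub_left volume p.2.1).skew_product
      (g := fun y z => p.2.2 - z + (y * p.1 - x * p.2.1) / 2) (by fun_prop)
      (Eventually.of_forall fun y =>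
        ((measurePreserving_add_right volume _).comp (Measure.measurePreserving_sub_left volume p.2.2)).map_eq)
  exact (Measure.measurePreserving_sub_left volume p.1).skew_product
      (g := fun x (w : ℝ × ℝ) => (p.2.1 - w.1, p.2.2 - w.2 + (w.1 * p.1 - x * p.2.1) / 2))
      (by fun_prop) (Eventually.of_forall fun x => (h1 x).map_eq)

theorem continuous_rel (s : ℝ) (p : Point) : Continuous fun q => rel s q p := by
  unfold rel; fun_prop

theorem continuous_act (s : ℝ) (p : Point) : Continuous (act s p) := by
  unfold act; fun_prop

/-- The homeomorphism `q ↦ δ_{1/s} (q⁻¹ p)`. -/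
noncomputable def relHomeo {s : ℝ} (hs : s ≠ 0) (p : Point) : Point ≃ₜ Point where
  toFun q := rel s q p
  invFun v := act s p v
  left_inv q := act_rel hs p q
  right_inv v := rel_act hs p v
  continuous_toFun := continuous_rel s p
  continuous_invFun := continuous_act s p

theorem map_rel {s : ℝ} (hs : 0 < s) (p : Point) :
    (volume : Measure Point).map (fun q => rel s q p) = ENNReal.ofReal (s ^ 4) • volume := by
  have h := map_dilation (inv_pos.2 hs)
  rw [← (measurePreserving_inv_mul p).map_eq, Measure.map_map (by fun_prop) (by fun_prop)] at h
  rw [inv_pow s 4, inv_inv, (measurePreserving_inv_mul p).map_eq] at h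
  rw [← h]
  congr 1
  funext q
  simp only [rel, Function.comp_apply]
  ext <;> simp <;> field_simp

theorem integral_rel {s : ℝ} (hs : 0 < s) (p : Point) (F : Point → ℝ) :
    ∫ v, F v = (s ^ 4)⁻¹ * ∫ q, F (rel s q p) := by
  have h := (relHomeo hs.ne' p).measurableEmbedding.integral_map (μ := volume) F
  change ∫ v, F v ∂(volume.map fun q => rel s q p) = ∫ q, F (rel s q p) at h
  rw [map_rel hs, integral_smul_measure, ENNReal.toReal_ofReal (by positivity), smul_eq_mul] at h
  rw [← h, inv_mul_cancel_left₀ (by positivity)]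

/-- The average of `f` against the kernel `k` dilated by `s` and translated to `p`. -/
noncomputable def avg (s : ℝ) (k f : Point → ℝ) (p : Point) : ℝ := ∫ v, f (act s p v) * k v

/-- The definition of `avg` suits continuity down to `s = 0` and variance computations. In this
second form `s` and `p` enter only through the kernel and the prefactor, so derivatives never fall
on `f`. -/
theorem avg_eq {s : ℝ} (hs : 0 < s) (k f : Point → ℝ) (p : Point) :
    avg s k f p = (s ^ 4)⁻¹ * ∫ q, f q * k (rel s q p) := by
  rw [avg, integral_rel hs p]
  simp only [act_rel hs.ne']

theorem mul_zero_right (p : Point) : mul p (0, 0, 0) = p := by simp [mul]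

/-- Left invariance of `X` and its homogeneity of degree one under dilations; the latter is the
source of the factor `s⁻¹` in `X_avg`. -/
theorem rel_mul_X {s : ℝ} (hs : s ≠ 0) (q p : Point) (ε : ℝ) :
    rel s q (mul p (ε, 0, 0)) = mul (rel s q p) (ε / s, 0, 0) := by
  simp only [rel, mul]
  ext <;> simp <;> field_simp <;> ring

theorem rel_mul_Y {s : ℝ} (hs : s ≠ 0) (q p : Point) (ε : ℝ) :
    rel s q (mul p (0, ε, 0)) = mul (rel s q p) (0, ε / s, 0) := by
  simp only [rel, mul]
  ext <;> simp <;> field_simp <;> ring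

theorem continuous_rel_schwartz (k : 𝓢(Point, ℝ)) (s : ℝ) (p : Point) :
    Continuous fun q => k (rel s q p) := k.continuous.comp (continuous_rel s p)

theorem integrable_mul_rel {f : Point → ℝ} (hf : Continuous f) (hc : HasCompactSupport f)
    (k : 𝓢(Point, ℝ)) (s : ℝ) (p : Point) : Integrable fun q => f q * k (rel s q p) :=
  (hf.mul (continuous_rel_schwartz k s p)).integrable_of_hasCompactSupport hc.mul_right

theorem hasDerivAt_avg_flow {f : Point → ℝ} (hf : Continuous f) (hc : HasCompactSupport f)
    (k k' : 𝓢(Point, ℝ)) {s : ℝ} (hs : 0 < s) (γ : ℝ → Point)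
    (hγ : ∀ q ε, HasDerivAt (fun ε => k (rel s q (γ ε))) (s⁻¹ * k' (rel s q (γ ε))) ε) (ε₀ : ℝ) :
    HasDerivAt (fun ε => avg s k f (γ ε)) (s⁻¹ * avg s k' f (γ ε₀)) ε₀ := by
  have h := hasDerivAt_integral_of_dominated_loc_of_deriv_le (μ := (volume : Measure Point))
    (F := fun ε q => f q * k (rel s q (γ ε))) (F' := fun ε q => f q * (s⁻¹ * k' (rel s q (γ ε))))
    (x₀ := ε₀) (s := univ) (bound := fun q => ‖f q‖ * (s⁻¹ * SchwartzMap.seminorm ℝ 0 0 k'))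
    univ_mem
    (Eventually.of_forall fun ε => (integrable_mul_rel hf hc k s _).aestronglyMeasurable)
    (integrable_mul_rel hf hc k s _)
    ((hf.mul (continuous_const.mul (continuous_rel_schwartz k' s _))).aestronglyMeasurable)
    (Eventually.of_forall fun q ε _ => ?_)
    ((hf.integrable_of_hasCompactSupport hc).norm.mul_const _)
    (Eventually.of_forall fun q ε _ => (hγ q ε).const_mul _)
  · have h2 := h.2.const_mul (s ^ 4)⁻¹
    have e1 : (fun ε => avg s k f (γ ε)) = fun ε => (s ^ 4)⁻¹ * ∫ q, f q * k (rel s q (γ ε)) :=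
      funext fun ε => avg_eq hs _ _ _
    rw [e1]
    refine h2.congr_deriv ?_
    rw [avg_eq hs, ← integral_const_mul, ← integral_const_mul, ← integral_const_mul]
    congr 1
    funext q; ring
  · rw [norm_mul, norm_mul, norm_inv, Real.norm_of_nonneg hs.le]
    gcongr
    exact SchwartzMap.norm_le_seminorm ℝ k' _

theorem X_avg {f : Point → ℝ} (hf : Continuous f) (hc : HasCompactSupport f) (k : 𝓢(Point, ℝ))
    {s : ℝ} (hs : 0 < s) (p : Point) :
    X (avg s k f) p = s⁻¹ * avg s (schwartzX k) f p := by
  have h := hasDerivAt_avg_flow hf hc k (schwartzX k) hs (fun ε => mul p (ε, 0, 0)) (fun q ε => ?_) 0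
  · rw [X, h.deriv, mul_zero_right]
  · simp only [rel_mul_X hs.ne']
    have := (hasDerivAt_flow_X k (rel s q p) (ε / s)).comp ε ((hasDerivAt_id ε).div_const s)
    refine this.congr_deriv ?_
    rw [one_div, mul_comm]

theorem Y_avg {f : Point → ℝ} (hf : Continuous f) (hc : HasCompactSupport f) (k : 𝓢(Point, ℝ))
    {s : ℝ} (hs : 0 < s) (p : Point) :
    Y (avg s k f) p = s⁻¹ * avg s (schwartzY k) f p := by
  have h := hasDerivAt_avg_flow hf hc k (schwartzY k) hs (fun ε => mul p (0, ε, 0)) (fun q ε => ?_) 0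
  · rw [Y, h.deriv, mul_zero_right]
  · simp only [rel_mul_Y hs.ne']
    have := (hasDerivAt_flow_Y k (rel s q p) (ε / s)).comp ε ((hasDerivAt_id ε).div_const s)
    refine this.congr_deriv ?_
    rw [one_div, mul_comm]

theorem L_avg {f : Point → ℝ} (hf : Continuous f) (hc : HasCompactSupport f) (k : 𝓢(Point, ℝ))
    {s : ℝ} (hs : 0 < s) (p : Point) :
    L (avg s k f) p = (s ^ 2)⁻¹ * avg s (schwartzL k) f p := by
  have hX : X (avg s k f) = fun p => s⁻¹ * avg s (schwartzX k) f p := funext (X_avg hf hc k hs)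
  have hY : Y (avg s k f) = fun p => s⁻¹ * avg s (schwartzY k) f p := funext (Y_avg hf hc k hs)
  have hX2 : X (fun p => s⁻¹ * avg s (schwartzX k) f p) p = s⁻¹ * X (avg s (schwartzX k) f) p := by
    simp only [X, deriv_const_mul_field']
  have hY2 : Y (fun p => s⁻¹ * avg s (schwartzY k) f p) p = s⁻¹ * Y (avg s (schwartzY k) f) p := by
    simp only [Y, deriv_const_mul_field']
  rw [L, hX, hY, hX2, hY2, X_avg hf hc _ hs, Y_avg hf hc _ hs, avg_eq hs, avg_eq hs, avg_eq hs]
  have : ∫ q, f q * schwartzL k (rel s q p) = (∫ q, f q * schwartzX (schwartzX k) (rel s q p)) +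
      ∫ q, f q * schwartzY (schwartzY k) (rel s q p) := by
    rw [← integral_add (integrable_mul_rel hf hc _ s p) (integrable_mul_rel hf hc _ s p)]
    simp only [schwartzL, add_apply, mul_add]
  rw [this]
  field_simp

/-- The integral is viewed as the convolution of the constant `1` with a compactly supported
function depending on the parameter `p`, evaluated at `0`. Smooth dependence of convolutions on
parameters then applies. -/
theorem contDiff_avg {f : Point → ℝ} (hf : ContDiff ℝ ∞ f) (hc : HasCompactSupport f)
    (k : 𝓢(Point, ℝ)) {s : ℝ} (hs : 0 < s) : ContDiff ℝ ∞ (avg s k f) := by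
  have hk : IsCompact (-tsupport f) := hc.isCompact.neg
  have h := contDiffOn_convolution_right_with_param (μ := (volume : Measure Point))
    (ContinuousLinearMap.mul ℝ ℝ) (f := fun _ : Point => (1 : ℝ)) (n := (⊤ : ℕ∞))
    (g := fun (p : Point) (x : Point) => f (-x) * k (rel s (-x) p)) (s := univ) isOpen_univ hk
    (fun p x _ hx => by
      have h0 : f (-x) = 0 := image_eq_zero_of_notMem_tsupport fun hx' => hx (by simpa using hx')
      simp only [h0, zero_mul])
    (continuous_const.locallyIntegrable)
    (by
      refine ContDiff.contDiffOn ?_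
      have hk' : ContDiff ℝ ∞ k := k.smooth ⊤
      have hr : ContDiff ℝ ∞ fun w : Point × Point => rel s (-w.2) w.1 := by
        unfold rel; simp only [div_eq_mul_inv]; fun_prop
      exact (hf.comp contDiff_snd.neg).mul (hk'.comp hr))
  have h2 : avg s k f = fun p => (s ^ 4)⁻¹ *
      ((fun q : Point × Point => ((fun _ : Point => (1 : ℝ)) ⋆[ContinuousLinearMap.mul ℝ ℝ, volume]
        (fun x : Point => f (-x) * k (rel s (-x) q.1))) q.2) (p, 0)) := by
    funext p
    rw [avg_eq hs]
    simp [convolution_def]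
  rw [h2]
  refine contDiff_const.mul ?_
  rw [univ_prod_univ, contDiffOn_univ] at h
  exact h.comp (contDiff_id.prodMk contDiff_const)

theorem continuous_avg_sqrt {f : Point → ℝ} (hf : Continuous f) (hc : HasCompactSupport f)
    (k : 𝓢(Point, ℝ)) : Continuous fun q : ℝ × Point => avg (Real.sqrt q.1) k f q.2 := by
  obtain ⟨C, hC⟩ := hf.bounded_above_of_compact_support hc
  unfold avg
  refine continuous_of_dominated (bound := fun v => C * ‖k v‖) (fun q => ?_) (fun q => ?_)
    (k.integrable.norm.const_mul C) (Eventually.of_forall fun v => ?_)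
  · exact ((hf.comp (continuous_act _ _)).mul k.continuous).aestronglyMeasurable
  · refine Eventually.of_forall fun v => ?_
    rw [norm_mul]
    gcongr
    exact hC _
  · refine (hf.comp ?_).mul continuous_const
    unfold act
    fun_prop

theorem abs_avg_le {f : Point → ℝ} {C : ℝ} (hC : ∀ q, ‖f q‖ ≤ C) (k : 𝓢(Point, ℝ)) (s : ℝ)
    (p : Point) : |avg s k f p| ≤ C * ∫ v, ‖k v‖ := by
  rw [avg, ← integral_const_mul, ← Real.norm_eq_abs]
  have hk : Integrable (fun v => ‖k v‖) := k.integrable.norm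
  refine norm_integral_le_of_norm_le (hk.const_mul C) (Eventually.of_forall fun v => ?_)
  rw [norm_mul]
  gcongr
  exact hC _

theorem hasDerivAt_rel_sqrt (q p : Point) {t : ℝ} (ht : 0 < t) :
    HasDerivAt (fun t => rel (Real.sqrt t) q p)
      (-(2 * t)⁻¹ • (((rel (Real.sqrt t) q p).1, (rel (Real.sqrt t) q p).2.1,
        2 * (rel (Real.sqrt t) q p).2.2) : Point)) t := by
  have hs := Real.sqrt_pos.2 ht
  have hst := Real.sq_sqrt ht.le
  have h1 : HasDerivAt (fun t => (Real.sqrt t)⁻¹) (-(2 * t)⁻¹ * (Real.sqrt t)⁻¹) t := by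
    refine ((Real.hasDerivAt_sqrt ht.ne').inv hs.ne').congr_deriv ?_
    rw [hst]; field_simp
  have h2 : HasDerivAt (fun t => (Real.sqrt t ^ 2)⁻¹) (-(2 * t)⁻¹ * (2 * (Real.sqrt t ^ 2)⁻¹)) t := by
    refine (((Real.hasDerivAt_sqrt ht.ne').pow 2).inv (pow_ne_zero 2 hs.ne')).congr_deriv ?_
    simp only [Nat.cast_ofNat, Pi.pow_apply]
    rw [hst]; field_simp; simp
  simp only [rel, div_eq_mul_inv]
  refine HasDerivAt.prodMk ?_ (HasDerivAt.prodMk ?_ ?_)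
  · exact (h1.const_mul _).congr_deriv (by simp only [smul_eq_mul]; ring)
  · exact (h1.const_mul _).congr_deriv (by simp only [smul_eq_mul]; ring)
  · exact (h2.const_mul _).congr_deriv (by simp only [smul_eq_mul]; ring)

/-- The time derivative acts as `-(D + 4) / (2t)` on the dilated kernel, which
`schwartzL_heatKernel` turns into `L / t`. -/
theorem hasDerivAt_heatKernel_rel (q p : Point) {t : ℝ} (ht : 0 < t) :
    HasDerivAt (fun t => (t ^ 2)⁻¹ * heatKernel (rel (Real.sqrt t) q p))
      ((t ^ 3)⁻¹ * schwartzL heatKernel (rel (Real.sqrt t) q p)) t := by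
  have h1 := (heatKernel.hasFDerivAt (rel (Real.sqrt t) q p)).comp_hasDerivAt t
    (hasDerivAt_rel_sqrt q p ht)
  have h2 : HasDerivAt (fun t : ℝ => (t ^ 2)⁻¹) (-2 * (t ^ 3)⁻¹) t := by
    refine (((hasDerivAt_id t).pow 2).inv (by simp [ht.ne'])).congr_deriv ?_
    simp; field_simp
  refine (h2.mul h1).congr_deriv ?_
  rw [schwartzL_heatKernel, map_smul, smul_eq_mul, Function.comp_apply]
  field_simp
  ring

theorem hasDerivAt_avg_heatKernel {f : Point → ℝ} (hf : Continuous f) (hc : HasCompactSupport f)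
    (p : Point) {t : ℝ} (ht : 0 < t) :
    HasDerivAt (fun t => avg (Real.sqrt t) heatKernel f p)
      (L (avg (Real.sqrt t) heatKernel f) p) t := by
  have h4 : ∀ {t : ℝ}, 0 < t → Real.sqrt t ^ 4 = t ^ 2 := fun {t} ht => by
    rw [show 4 = 2 * 2 from rfl, pow_mul, Real.sq_sqrt ht.le]
  have h := hasDerivAt_integral_of_dominated_loc_of_deriv_le (μ := (volume : Measure Point))
    (F := fun t q => f q * ((t ^ 2)⁻¹ * heatKernel (rel (Real.sqrt t) q p)))
    (F' := fun t q => f q * ((t ^ 3)⁻¹ * schwartzL heatKernel (rel (Real.sqrt t) q p)))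
    (x₀ := t) (s := Ioi (t / 2))
    (bound := fun q => ‖f q‖ * (((t / 2) ^ 3)⁻¹ * SchwartzMap.seminorm ℝ 0 0 (schwartzL heatKernel)))
    (Ioi_mem_nhds (by linarith))
    (Eventually.of_forall fun ε =>
      (hf.mul (continuous_const.mul (continuous_rel_schwartz _ _ _))).aestronglyMeasurable)
    ((hf.mul (continuous_const.mul (continuous_rel_schwartz _ _ _))).integrable_of_hasCompactSupport
      hc.mul_right)
    ((hf.mul (continuous_const.mul (continuous_rel_schwartz _ _ _))).aestronglyMeasurable)
    (Eventually.of_forall fun q t' ht' => ?_)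
    ((hf.integrable_of_hasCompactSupport hc).norm.mul_const _)
    (Eventually.of_forall fun q t' ht' => (hasDerivAt_heatKernel_rel q p ?_).const_mul _)
  · have hev : (fun t => avg (Real.sqrt t) heatKernel f p) =ᶠ[𝓝 t]
        fun t => ∫ q, f q * ((t ^ 2)⁻¹ * heatKernel (rel (Real.sqrt t) q p)) := by
      filter_upwards [Ioi_mem_nhds ht] with t' ht'
      rw [avg_eq (Real.sqrt_pos.2 ht'), h4 ht', ← integral_const_mul]
      congr 1; funext q; ring
    refine (h.2.congr_of_eventuallyEq hev).congr_deriv ?_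
    rw [L_avg hf hc _ (Real.sqrt_pos.2 ht), avg_eq (Real.sqrt_pos.2 ht), h4 ht, Real.sq_sqrt ht.le,
      ← integral_const_mul, ← integral_const_mul]
    congr 1; funext q; field_simp
  · have h0 : t / 2 < t' := ht'
    have h1 : 0 < t' := by linarith
    rw [norm_mul, norm_mul, norm_inv, norm_pow, Real.norm_of_nonneg h1.le]
    gcongr
    exact SchwartzMap.norm_le_seminorm ℝ _ _
  · have h0 : t / 2 < t' := ht'
    linarith

/-- At scale zero the dilation collapses onto the identity, leaving `f p` times the total mass one.
-/
theorem avg_zero (f : Point → ℝ) : avg (Real.sqrt 0) heatKernel f = f := by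
  funext p
  simp [avg, act, integral_const_mul, integral_heatKernel]

theorem isHeatSolution_avg {f : Point → ℝ} (hf : ContDiff ℝ ∞ f) (hc : HasCompactSupport f) :
    IsHeatSolution f fun t => avg (Real.sqrt t) heatKernel f where
  initial := avg_zero f
  continuousOn := (continuous_avg_sqrt hf.continuous hc heatKernel).continuousOn
  bounded := by
    obtain ⟨C, hC⟩ := hf.continuous.bounded_above_of_compact_support hc
    exact ⟨_, fun t _ p => abs_avg_le hC heatKernel _ p⟩
  contDiff t ht := (contDiff_avg hf hc heatKernel (Real.sqrt_pos.2 ht)).of_le (by norm_cast)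
  heat t ht p := hasDerivAt_avg_heatKernel hf.continuous hc p ht

theorem P_eq_avg {f : Point → ℝ} (hf : ContDiff ℝ ∞ f) (hc : HasCompactSupport f) {t : ℝ}
    (ht : 0 ≤ t) : P t f = avg (Real.sqrt t) heatKernel f :=
  ((isHeatSolution_avg hf hc).eq_P ht).symm

/-! ### Nonnegativity of the kernel. -/

/-- If the kernel were negative near `v`, a nonnegative bump supported there would evolve to a
negative value at the origin at time one, against the minimum principle. The bump is reflected
because `act 1 0 w = -w`. -/
theorem heatKernel_nonneg (v : Point) : 0 ≤ heatKernel v := by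
  by_contra! hv
  have hU : {w | heatKernel w < 0} ∈ 𝓝 v :=
    (isOpen_lt heatKernel.continuous continuous_const).mem_nhds hv
  obtain ⟨φ, hφs, hφc, hφ, hφr, hφv⟩ := exists_contDiff_tsupport_subset (n := (⊤ : ℕ∞)) hU
  have hφ0 : ∀ w, 0 ≤ φ w := fun w => (hφr ⟨w, rfl⟩).1
  have hsol := isHeatSolution_avg (f := fun q => φ (-q)) (hφ.comp contDiff_neg)
    (hφc.comp_homeomorph (Homeomorph.neg Point))
  obtain ⟨C, hC⟩ := hsol.bounded
  have h1 := nonneg_of_heat hsol.continuousOn hC hsol.contDiff hsol.heat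
    (fun p => by rw [hsol.initial]; exact hφ0 _) zero_le_one (0 : Point)
  have h2 : avg (Real.sqrt 1) heatKernel (fun q => φ (-q)) 0 = ∫ w, φ w * heatKernel w := by
    simp [avg, act]
  rw [h2] at h1
  have h3 : 0 < ∫ w, φ w * -heatKernel w := by
    refine (hφ.continuous.mul heatKernel.continuous.neg).integral_pos_of_hasCompactSupport_nonneg_nonzero
      hφc.mul_right (fun w => ?_) (x := v) ?_
    · by_cases hw : w ∈ tsupport φ
      · exact mul_nonneg (hφ0 w) (neg_nonneg.2 (hφs hw : heatKernel w < 0).le)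
      · simp [image_eq_zero_of_notMem_tsupport hw]
    · simp [hφv, hv.ne]
  simp only [mul_neg, integral_neg] at h3
  linarith

/-! ### Integration by parts for `X` and `Y`. -/

/-- Integration by parts of a Schwartz function against a bounded function with bounded
derivative. -/
theorem integral_mul_lineDeriv {ψ : Point → ℝ} {ψ' : Point → Point →L[ℝ] ℝ} {C D : ℝ}
    (hψ : ∀ p, HasFDerivAt ψ (ψ' p) p) (hC : ∀ p, ‖ψ p‖ ≤ C) (hψ' : Continuous ψ') (i : Fin 3)
    (hD : ∀ p, ‖ψ' p (basisVec i)‖ ≤ D) (g : 𝓢(Point, ℝ)) :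
    ∫ p, ψ p * (∂_{basisVec i} g : 𝓢(Point, ℝ)) p = -∫ p, ψ' p (basisVec i) * g p := by
  have hc : Continuous ψ := continuous_iff_continuousAt.2 fun p => (hψ p).continuousAt
  have hf : fderiv ℝ ψ = ψ' := funext fun p => (hψ p).fderiv
  have hcd : Continuous fun p => ψ' p (basisVec i) := hψ'.clm_apply continuous_const
  have h := integral_mul_fderiv_eq_neg_fderiv_mul_of_integrable (μ := (volume : Measure Point))
    (f := ψ) (g := g) (v := basisVec i)
    (by rw [hf]; exact (g.integrable).bdd_mul hcd.aestronglyMeasurable (Eventually.of_forall hD))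
    (by
      simp only [← lineDeriv_apply]
      exact (SchwartzMap.integrable _).bdd_mul hc.aestronglyMeasurable (Eventually.of_forall hC))
    (g.integrable.bdd_mul hc.aestronglyMeasurable (Eventually.of_forall hC))
    (fun p _ => (hψ p).differentiableAt) (fun p _ => (g.hasFDerivAt p).differentiableAt)
  simp only [← lineDeriv_apply, hf] at h
  exact h

/-- Multiplication of Schwartz functions by `x`. -/
noncomputable def mulX (f : 𝓢(Point, ℝ)) : 𝓢(Point, ℝ) :=
  SchwartzMap.smulLeftCLM ℝ (fun p : Point => p.1) f

/-- Multiplication of Schwartz functions by `y`. -/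
noncomputable def mulY (f : 𝓢(Point, ℝ)) : 𝓢(Point, ℝ) :=
  SchwartzMap.smulLeftCLM ℝ (fun p : Point => p.2.1) f

theorem hasTemperateGrowth_snd_snd : (fun p : Point => p.2.2).HasTemperateGrowth :=
  ((ContinuousLinearMap.snd ℝ ℝ ℝ).comp (ContinuousLinearMap.snd ℝ ℝ (ℝ × ℝ))).hasTemperateGrowth

theorem mulX_apply (f : 𝓢(Point, ℝ)) (p : Point) : mulX f p = p.1 * f p :=
  SchwartzMap.smulLeftCLM_apply_apply hasTemperateGrowth_fst f p

theorem mulY_apply (f : 𝓢(Point, ℝ)) (p : Point) : mulY f p = p.2.1 * f p :=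
  SchwartzMap.smulLeftCLM_apply_apply hasTemperateGrowth_snd_fst f p

theorem fderiv_fst_apply (p v : Point) : fderiv ℝ (fun p : Point => p.1) p v = v.1 :=
  congrArg (fun A : Point →L[ℝ] ℝ => A v) (ContinuousLinearMap.fst ℝ ℝ (ℝ × ℝ)).fderiv

theorem fderiv_snd_fst_apply (p v : Point) : fderiv ℝ (fun p : Point => p.2.1) p v = v.2.1 :=
  congrArg (fun A : Point →L[ℝ] ℝ => A v)
    ((ContinuousLinearMap.fst ℝ ℝ ℝ).comp (ContinuousLinearMap.snd ℝ ℝ (ℝ × ℝ))).fderiv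

theorem fderiv_snd_snd_apply (p v : Point) : fderiv ℝ (fun p : Point => p.2.2) p v = v.2.2 :=
  congrArg (fun A : Point →L[ℝ] ℝ => A v)
    ((ContinuousLinearMap.snd ℝ ℝ ℝ).comp (ContinuousLinearMap.snd ℝ ℝ (ℝ × ℝ))).fderiv

theorem lineDeriv_mulX_two (f : 𝓢(Point, ℝ)) :
    (∂_{basisVec 2} (mulX f) : 𝓢(Point, ℝ)) = mulX (∂_{basisVec 2} f) := by
  ext p
  rw [mulX, lineDeriv_smulLeft hasTemperateGrowth_fst, fderiv_fst_apply, mulX_apply]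
  simp [basisVec]

theorem lineDeriv_mulY_two (f : 𝓢(Point, ℝ)) :
    (∂_{basisVec 2} (mulY f) : 𝓢(Point, ℝ)) = mulY (∂_{basisVec 2} f) := by
  ext p
  rw [mulY, lineDeriv_smulLeft hasTemperateGrowth_snd_fst, fderiv_snd_fst_apply, mulY_apply]
  simp [basisVec]

section Parts

variable {ψ : Point → ℝ} {ψ' : Point → Point →L[ℝ] ℝ} {C D : ℝ}

theorem integrable_bdd_mul {φ : Point → ℝ} (hφ : Continuous φ) {C : ℝ} (hC : ∀ p, ‖φ p‖ ≤ C)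
    (g : 𝓢(Point, ℝ)) : Integrable fun p => φ p * g p :=
  g.integrable.bdd_mul hφ.aestronglyMeasurable (Eventually.of_forall hC)

theorem integral_mul_schwartzX (hψ : ∀ p, HasFDerivAt ψ (ψ' p) p) (hC : ∀ p, ‖ψ p‖ ≤ C)
    (hψ' : Continuous ψ') (hD : ∀ i p, ‖ψ' p (basisVec i)‖ ≤ D) (g : 𝓢(Point, ℝ)) :
    ∫ p, ψ p * schwartzX g p =
      -∫ p, (ψ' p (basisVec 0) - p.2.1 / 2 * ψ' p (basisVec 2)) * g p := by
  have hc : Continuous ψ := continuous_iff_continuousAt.2 fun p => (hψ p).continuousAt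
  have hcd : ∀ i, Continuous fun p => ψ' p (basisVec i) := fun i => hψ'.clm_apply continuous_const
  have h0 := integral_mul_lineDeriv hψ hC hψ' 0 (hD 0) g
  have h2 := integral_mul_lineDeriv hψ hC hψ' 2 (hD 2) (mulY g)
  have e1 : (fun p => ψ p * schwartzX g p) = fun p => ψ p * (∂_{basisVec 0} g : 𝓢(Point, ℝ)) p -
      (1 / 2) * (ψ p * (∂_{basisVec 2} (mulY g) : 𝓢(Point, ℝ)) p) := by
    funext p
    rw [lineDeriv_mulY_two, mulY_apply, schwartzX_apply]; ring
  have e2 : (fun p => (ψ' p (basisVec 0) - p.2.1 / 2 * ψ' p (basisVec 2)) * g p) = fun p =>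
      ψ' p (basisVec 0) * g p - (1 / 2) * (ψ' p (basisVec 2) * mulY g p) := by
    funext p
    rw [mulY_apply]; ring
  rw [e1, e2, integral_sub (integrable_bdd_mul hc hC _) ((integrable_bdd_mul hc hC _).const_mul _),
    integral_sub (integrable_bdd_mul (hcd 0) (hD 0) _)
      ((integrable_bdd_mul (hcd 2) (hD 2) _).const_mul _),
    integral_const_mul, integral_const_mul, h0, h2]
  ring

theorem integral_mul_schwartzY (hψ : ∀ p, HasFDerivAt ψ (ψ' p) p) (hC : ∀ p, ‖ψ p‖ ≤ C)
    (hψ' : Continuous ψ') (hD : ∀ i p, ‖ψ' p (basisVec i)‖ ≤ D) (g : 𝓢(Point, ℝ)) :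
    ∫ p, ψ p * schwartzY g p =
      -∫ p, (ψ' p (basisVec 1) + p.1 / 2 * ψ' p (basisVec 2)) * g p := by
  have hc : Continuous ψ := continuous_iff_continuousAt.2 fun p => (hψ p).continuousAt
  have hcd : ∀ i, Continuous fun p => ψ' p (basisVec i) := fun i => hψ'.clm_apply continuous_const
  have h0 := integral_mul_lineDeriv hψ hC hψ' 1 (hD 1) g
  have h2 := integral_mul_lineDeriv hψ hC hψ' 2 (hD 2) (mulX g)
  have e1 : (fun p => ψ p * schwartzY g p) = fun p => ψ p * (∂_{basisVec 1} g : 𝓢(Point, ℝ)) p +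
      (1 / 2) * (ψ p * (∂_{basisVec 2} (mulX g) : 𝓢(Point, ℝ)) p) := by
    funext p
    rw [lineDeriv_mulX_two, mulX_apply, schwartzY_apply]; ring
  have e2 : (fun p => (ψ' p (basisVec 1) + p.1 / 2 * ψ' p (basisVec 2)) * g p) = fun p =>
      ψ' p (basisVec 1) * g p + (1 / 2) * (ψ' p (basisVec 2) * mulX g p) := by
    funext p
    rw [mulX_apply]; ring
  rw [e1, e2, integral_add (integrable_bdd_mul hc hC _) ((integrable_bdd_mul hc hC _).const_mul _),
    integral_add (integrable_bdd_mul (hcd 1) (hD 1) _)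
      ((integrable_bdd_mul (hcd 2) (hD 2) _).const_mul _),
    integral_const_mul, integral_const_mul, h0, h2]
  ring

end Parts

theorem integral_schwartzX (g : 𝓢(Point, ℝ)) : ∫ p, schwartzX g p = 0 := by
  have h := integral_mul_schwartzX (ψ := fun _ => 1) (ψ' := fun _ => 0) (C := 1) (D := 0)
    (fun p => hasFDerivAt_const _ _) (by simp) continuous_const (by simp) g
  simpa using h

theorem integral_schwartzY (g : 𝓢(Point, ℝ)) : ∫ p, schwartzY g p = 0 := by
  have h := integral_mul_schwartzY (ψ := fun _ => 1) (ψ' := fun _ => 0) (C := 1) (D := 0)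
    (fun p => hasFDerivAt_const _ _) (by simp) continuous_const (by simp) g
  simpa using h

/-! ### The regularized Fisher information. -/

/-- The logarithm of the regularized heat kernel. -/
noncomputable def logKernel (ε : ℝ) (p : Point) : ℝ := Real.log (1 + heatKernel p / ε)

theorem one_add_pos {ε : ℝ} (hε : 0 < ε) (p : Point) : 0 < 1 + heatKernel p / ε := by
  have := heatKernel_nonneg p
  positivity

theorem heatKernel_add_pos {ε : ℝ} (hε : 0 < ε) (p : Point) : 0 < heatKernel p + ε := by
  have := heatKernel_nonneg p
  positivity

theorem logKernel_nonneg {ε : ℝ} (hε : 0 < ε) (p : Point) : 0 ≤ logKernel ε p :=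
  Real.log_nonneg (by have := heatKernel_nonneg p; have : 0 ≤ heatKernel p / ε := by positivity
                      linarith)

theorem logKernel_le {ε : ℝ} (hε : 0 < ε) (p : Point) : logKernel ε p ≤ heatKernel p / ε := by
  have := Real.log_le_sub_one_of_pos (one_add_pos hε p)
  unfold logKernel; linarith

theorem logKernel_norm_le {ε : ℝ} (hε : 0 < ε) (p : Point) :
    ‖logKernel ε p‖ ≤ SchwartzMap.seminorm ℝ 0 0 heatKernel / ε := by
  rw [Real.norm_of_nonneg (logKernel_nonneg hε p)]
  refine (logKernel_le hε p).trans ?_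
  gcongr
  exact (le_abs_self _).trans (SchwartzMap.norm_le_seminorm ℝ heatKernel p)

theorem hasFDerivAt_logKernel {ε : ℝ} (hε : 0 < ε) (p : Point) :
    HasFDerivAt (logKernel ε) ((heatKernel p + ε)⁻¹ • fderiv ℝ heatKernel p) p := by
  have h1 := (((heatKernel.hasFDerivAt p).mul_const ε⁻¹).const_add 1).log
    (by rw [← div_eq_mul_inv]; exact (one_add_pos hε p).ne')
  have e : logKernel ε = fun p => Real.log (1 + heatKernel p * ε⁻¹) := by
    funext q; rw [logKernel, div_eq_mul_inv]
  rw [e]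
  refine h1.congr_fderiv ?_
  rw [smul_smul, ← mul_inv, add_mul, one_mul, inv_mul_cancel_right₀ hε.ne', add_comm]

theorem continuous_logKernel {ε : ℝ} (hε : 0 < ε) : Continuous (logKernel ε) :=
  continuous_iff_continuousAt.2 fun p => (hasFDerivAt_logKernel hε p).continuousAt

theorem continuous_logKernel_deriv {ε : ℝ} (hε : 0 < ε) :
    Continuous fun p => (heatKernel p + ε)⁻¹ • fderiv ℝ heatKernel p := by
  refine Continuous.smul ((heatKernel.continuous.add continuous_const).inv₀
    fun p => (heatKernel_add_pos hε p).ne') ?_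
  exact (heatKernel.smooth 1).continuous_fderiv (by norm_num)

theorem logKernel_deriv_bound {ε : ℝ} (hε : 0 < ε) : ∃ D, ∀ i p,
    ‖((heatKernel p + ε)⁻¹ • fderiv ℝ heatKernel p) (basisVec i)‖ ≤ D := by
  have h : ∀ i p, ‖((heatKernel p + ε)⁻¹ • fderiv ℝ heatKernel p) (basisVec i)‖ ≤
      ε⁻¹ * SchwartzMap.seminorm ℝ 0 0 (∂_{basisVec i} heatKernel) := by
    intro i p
    rw [smul_apply, norm_smul, ← lineDeriv_apply, norm_inv,
      Real.norm_of_nonneg (heatKernel_add_pos hε p).le]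
    gcongr
    · linarith [heatKernel_nonneg p]
    · exact SchwartzMap.norm_le_seminorm ℝ _ p
  refine ⟨∑ i, ε⁻¹ * SchwartzMap.seminorm ℝ 0 0 (∂_{basisVec i} heatKernel), fun i p => ?_⟩
  exact (h i p).trans (Finset.single_le_sum
    (f := fun i => ε⁻¹ * SchwartzMap.seminorm ℝ 0 0 (∂_{basisVec i} heatKernel))
    (fun j _ => by positivity) (Finset.mem_univ i))

theorem continuous_inv_add {ε : ℝ} (hε : 0 < ε) : Continuous fun p => (heatKernel p + ε)⁻¹ :=
  (heatKernel.continuous.add continuous_const).inv₀ fun p => (heatKernel_add_pos hε p).ne'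

theorem norm_inv_add_le {ε : ℝ} (hε : 0 < ε) (p : Point) : ‖(heatKernel p + ε)⁻¹‖ ≤ ε⁻¹ := by
  rw [norm_inv, Real.norm_of_nonneg (heatKernel_add_pos hε p).le]
  gcongr
  linarith [heatKernel_nonneg p]

theorem integrable_sq_div {ε : ℝ} (hε : 0 < ε) (k : 𝓢(Point, ℝ)) :
    Integrable fun p => k p ^ 2 / (heatKernel p + ε) := by
  have e : (fun p => k p ^ 2 / (heatKernel p + ε)) = fun p => ((heatKernel p + ε)⁻¹ * k p) * k p := by
    funext p; rw [div_eq_mul_inv]; ring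
  rw [e]
  refine integrable_bdd_mul ((continuous_inv_add hε).mul k.continuous)
    (C := ε⁻¹ * SchwartzMap.seminorm ℝ 0 0 k) (fun p => ?_) k
  rw [Pi.mul_apply, norm_mul]
  gcongr
  · exact norm_inv_add_le hε p
  · exact SchwartzMap.norm_le_seminorm ℝ k p

/-- Integration by parts, the gradient of `log (1 + h / ε)` being `∇h / (h + ε)`. Regularizing makes
the logarithm bounded with bounded coordinate derivatives, and it avoids dividing by zeros of `h`.
-/
theorem integral_logKernel_mul_schwartzL {ε : ℝ} (hε : 0 < ε) :
    ∫ p, logKernel ε p * schwartzL heatKernel p =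
      -((∫ p, schwartzX heatKernel p ^ 2 / (heatKernel p + ε)) +
        ∫ p, schwartzY heatKernel p ^ 2 / (heatKernel p + ε)) := by
  obtain ⟨D, hD⟩ := logKernel_deriv_bound hε
  have hc := continuous_logKernel hε
  have hC := logKernel_norm_le hε
  have h1 := integral_mul_schwartzX (hasFDerivAt_logKernel hε) hC (continuous_logKernel_deriv hε) hD
    (schwartzX heatKernel)
  have h2 := integral_mul_schwartzY (hasFDerivAt_logKernel hε) hC (continuous_logKernel_deriv hε) hD
    (schwartzY heatKernel)
  have e : (fun p => logKernel ε p * schwartzL heatKernel p) = fun p =>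
      logKernel ε p * schwartzX (schwartzX heatKernel) p +
        logKernel ε p * schwartzY (schwartzY heatKernel) p := by
    funext p; rw [schwartzL, add_apply]; ring
  rw [e, integral_add (integrable_bdd_mul hc hC _) (integrable_bdd_mul hc hC _), h1, h2, neg_add]
  congr 2
  · congr 1; funext p
    simp only [smul_apply, smul_eq_mul, ← lineDeriv_apply]
    rw [div_eq_mul_inv, schwartzX_apply]
    ring
  · congr 1; funext p
    simp only [smul_apply, smul_eq_mul, ← lineDeriv_apply]
    rw [div_eq_mul_inv, schwartzY_apply]
    ring

/-- `∫ w ∂ᵢ G = -∫ (∂ᵢ w) G` for a coordinate weight `w` and `G` dominated by a Schwartz function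
together with its derivative. -/
theorem integral_weight_mul {w G ψ : Point → ℝ} (hw : w.HasTemperateGrowth) {i : Fin 3}
    (hw1 : ∀ p, fderiv ℝ w p (basisVec i) = 1) {k : 𝓢(Point, ℝ)} {C : ℝ}
    (hG : ∀ p, HasFDerivAt G (ψ p • fderiv ℝ k p) p) (hψ : Continuous ψ) (hC : ∀ p, ‖ψ p‖ ≤ C)
    (hGk : ∀ p, ‖G p‖ ≤ C * ‖k p‖) :
    Integrable G ∧ Integrable (fun p => w p * (ψ p * (∂_{basisVec i} k : 𝓢(Point, ℝ)) p)) ∧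
    ∫ p, w p * (ψ p * (∂_{basisVec i} k : 𝓢(Point, ℝ)) p) = -∫ p, G p := by
  have hGc : Continuous G := continuous_iff_continuousAt.2 fun p => (hG p).continuousAt
  have hf : ∀ p, fderiv ℝ G p (basisVec i) = ψ p * (∂_{basisVec i} k : 𝓢(Point, ℝ)) p := fun p => by
    rw [(hG p).fderiv, smul_apply, smul_eq_mul, lineDeriv_apply]
  have i1 : Integrable G :=
    (k.integrable.norm.const_mul C).mono' hGc.aestronglyMeasurable (Eventually.of_forall hGk)
  have hwk : ∀ (f : 𝓢(Point, ℝ)) p, SchwartzMap.smulLeftCLM ℝ w f p = w p * f p := fun f p =>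
    SchwartzMap.smulLeftCLM_apply_apply hw f p
  have i2 : Integrable (fun p => w p * G p) := by
    refine (((SchwartzMap.smulLeftCLM ℝ w k).integrable).norm.const_mul C).mono'
      (hw.1.continuous.mul hGc).aestronglyMeasurable (Eventually.of_forall fun p => ?_)
    rw [hwk, norm_mul, norm_mul]
    calc ‖w p‖ * ‖G p‖ ≤ ‖w p‖ * (C * ‖k p‖) := by gcongr; exact hGk p
      _ = _ := by ring
  have i3 : Integrable (fun p => w p * (ψ p * (∂_{basisVec i} k : 𝓢(Point, ℝ)) p)) := by
    have := integrable_bdd_mul hψ hC (SchwartzMap.smulLeftCLM ℝ w (∂_{basisVec i} k))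
    simp only [hwk] at this
    refine this.congr (Eventually.of_forall fun p => ?_)
    simp only; ring
  refine ⟨i1, i3, ?_⟩
  have h := integral_mul_fderiv_eq_neg_fderiv_mul_of_integrable (μ := (volume : Measure Point))
    (f := w) (g := G) (v := basisVec i) (by simpa only [hw1, one_mul] using i1)
    (by simpa only [hf] using i3) i2 (fun p _ => hw.1.differentiable (by norm_num) p)
    (fun p _ => (hG p).differentiableAt)
  simpa only [hf, hw1, one_mul] using h

/-- A primitive of the logarithm evaluated at the heat kernel. -/
noncomputable def logPrimitive (ε : ℝ) (p : Point) : ℝ :=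
  (heatKernel p + ε) * logKernel ε p - heatKernel p

theorem hasFDerivAt_logPrimitive {ε : ℝ} (hε : 0 < ε) (p : Point) :
    HasFDerivAt (logPrimitive ε) (logKernel ε p • fderiv ℝ heatKernel p) p := by
  have h := (((heatKernel.hasFDerivAt p).add_const ε).mul (hasFDerivAt_logKernel hε p)).sub
    (heatKernel.hasFDerivAt p)
  refine h.congr_fderiv ?_
  rw [smul_smul, mul_inv_cancel₀ (heatKernel_add_pos hε p).ne', one_smul]
  abel

theorem logPrimitive_eq (ε : ℝ) (p : Point) :
    logPrimitive ε p = heatKernel p * logKernel ε p - (heatKernel p - ε * logKernel ε p) := by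
  rw [logPrimitive]; ring

theorem sub_logKernel_mem {ε : ℝ} (hε : 0 < ε) (p : Point) :
    0 ≤ heatKernel p - ε * logKernel ε p ∧ heatKernel p - ε * logKernel ε p ≤ heatKernel p := by
  have h1 := logKernel_le hε p
  have h2 := logKernel_nonneg hε p
  rw [le_div_iff₀ hε] at h1
  constructor <;> nlinarith

/-- Replace `L h` by `-(D h + 4 h) / 2`. With `G` for `logPrimitive ε`, `log (1 + h / ε) · D h = D
G` and `∫ D G = -4 ∫ G`, the divergence of the dilation field being `4`; what remains is `2 ∫ (G - h
log (1 + h / ε))`. -/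
theorem integral_dilation_logKernel {ε : ℝ} (hε : 0 < ε) :
    ∫ p, logKernel ε p * schwartzL heatKernel p =
      -2 * ∫ p, (heatKernel p - ε * logKernel ε p) := by
  set M := SchwartzMap.seminorm ℝ 0 0 heatKernel / ε with hM
  have hM0 : 0 ≤ M := by positivity
  -- The extra `1` lets the same constant bound `logPrimitive` by a multiple of the kernel.
  have hC : ∀ p, ‖logKernel ε p‖ ≤ M + 1 := fun p => (logKernel_norm_le hε p).trans (by linarith)
  have hc := continuous_logKernel hε
  have hG : ∀ p, ‖logPrimitive ε p‖ ≤ (M + 1) * ‖heatKernel p‖ := by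
    intro p
    obtain ⟨h1, h2⟩ := sub_logKernel_mem hε p
    have h3 := logKernel_norm_le hε p
    have h0 := heatKernel_nonneg p
    rw [logPrimitive_eq ε]
    calc ‖heatKernel p * logKernel ε p - (heatKernel p - ε * logKernel ε p)‖
        ≤ ‖heatKernel p * logKernel ε p‖ + ‖heatKernel p - ε * logKernel ε p‖ := norm_sub_le _ _
      _ ≤ ‖heatKernel p‖ * M + ‖heatKernel p‖ := by
          rw [norm_mul, Real.norm_of_nonneg h1, Real.norm_of_nonneg h0]
          gcongr
      _ = _ := by ring
  obtain ⟨i1, ix, ex⟩ := integral_weight_mul hasTemperateGrowth_fst (i := 0)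
    (fun p => by rw [fderiv_fst_apply]; rfl) (hasFDerivAt_logPrimitive hε) hc hC hG
  obtain ⟨-, iy, ey⟩ := integral_weight_mul hasTemperateGrowth_snd_fst (i := 1)
    (fun p => by rw [fderiv_snd_fst_apply]; rfl) (hasFDerivAt_logPrimitive hε) hc hC hG
  obtain ⟨-, iz, ez⟩ := integral_weight_mul hasTemperateGrowth_snd_snd (i := 2)
    (fun p => by rw [fderiv_snd_snd_apply]; rfl) (hasFDerivAt_logPrimitive hε) hc hC hG
  have ih := integrable_bdd_mul hc hC heatKernel
  have e : ∀ p, fderiv ℝ heatKernel p (p.1, p.2.1, 2 * p.2.2) =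
      p.1 * (∂_{basisVec 0} heatKernel : 𝓢(Point, ℝ)) p +
      p.2.1 * (∂_{basisVec 1} heatKernel : 𝓢(Point, ℝ)) p +
      2 * p.2.2 * (∂_{basisVec 2} heatKernel : 𝓢(Point, ℝ)) p := by
    intro p
    have e' : ((p.1, p.2.1, 2 * p.2.2) : Point) =
        p.1 • basisVec 0 + p.2.1 • basisVec 1 + (2 * p.2.2) • basisVec 2 := by
      ext <;> simp [basisVec]
    rw [e', map_add, map_add, map_smul, map_smul, map_smul, lineDeriv_apply, lineDeriv_apply,
      lineDeriv_apply]
    simp only [smul_eq_mul]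
  have e2 : (fun p => logKernel ε p * schwartzL heatKernel p) = fun p =>
      -(1 / 2) * (p.1 * (logKernel ε p * (∂_{basisVec 0} heatKernel : 𝓢(Point, ℝ)) p) +
        p.2.1 * (logKernel ε p * (∂_{basisVec 1} heatKernel : 𝓢(Point, ℝ)) p) +
        2 * (p.2.2 * (logKernel ε p * (∂_{basisVec 2} heatKernel : 𝓢(Point, ℝ)) p)) +
        4 * (logKernel ε p * heatKernel p)) := by
    funext p; rw [schwartzL_heatKernel, e]; ring
  have e3 : (fun p => heatKernel p - ε * logKernel ε p) = fun p =>
      logKernel ε p * heatKernel p - logPrimitive ε p := by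
    funext p; rw [logPrimitive_eq ε]; ring
  have lin : ∀ {A B C D : Point → ℝ}, Integrable A → Integrable B → Integrable C → Integrable D →
      ∫ p, (A p + B p + 2 * C p + 4 * D p) =
        (∫ p, A p) + (∫ p, B p) + (∫ p, 2 * C p) + ∫ p, 4 * D p := by
    intro A B C D hA hB hC hD
    have h12 : Integrable fun p => A p + B p := hA.add hB
    have h123 : Integrable fun p => A p + B p + 2 * C p := h12.add (hC.const_mul 2)
    rw [integral_add h123 (hD.const_mul 4), integral_add h12 (hC.const_mul 2), integral_add hA hB]
  rw [e2, e3, integral_const_mul, lin ix iy iz ih, integral_const_mul,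
    integral_const_mul, ex, ey, ez, integral_sub ih i1]
  ring

theorem integral_gam_div_add {ε : ℝ} (hε : 0 < ε) :
    ∫ p, (schwartzX heatKernel p ^ 2 / (heatKernel p + ε) +
        schwartzY heatKernel p ^ 2 / (heatKernel p + ε)) =
      2 * ∫ p, (heatKernel p - ε * logKernel ε p) := by
  rw [integral_add (integrable_sq_div hε _) (integrable_sq_div hε _)]
  linarith [integral_logKernel_mul_schwartzL hε, integral_dilation_logKernel hε]

/-- From `log (1 + x) ≤ 2 √x`; the bound tends to zero with `ε`, so the correction to the mass
disappears in the limit. -/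
theorem mul_logKernel_le {ε : ℝ} (hε : 0 < ε) (p : Point) : ε * logKernel ε p ≤ 2 * Real.sqrt (heatKernel p * ε) := by
  have h0 := heatKernel_nonneg p
  have h1 := one_add_pos hε p
  have h2 : logKernel ε p ≤ 2 * Real.sqrt (heatKernel p / ε) := by
    have h3 := Real.log_le_sub_one_of_pos (Real.sqrt_pos.2 h1)
    rw [Real.log_sqrt h1.le] at h3
    have h4 : Real.sqrt (1 + heatKernel p / ε) ≤ 1 + Real.sqrt (heatKernel p / ε) := by
      rw [Real.sqrt_le_left (by positivity)]
      have h5 := Real.sq_sqrt (show 0 ≤ heatKernel p / ε by positivity)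
      nlinarith [Real.sqrt_nonneg (heatKernel p / ε)]
    unfold logKernel
    linarith
  have h6 : Real.sqrt (heatKernel p * ε) = ε * Real.sqrt (heatKernel p / ε) := by
    rw [show heatKernel p * ε = ε ^ 2 * (heatKernel p / ε) by field_simp,
      Real.sqrt_mul (by positivity), Real.sqrt_sq hε.le]
  rw [h6]
  nlinarith

/-! ### Removing the regularization: the Fisher information is `2`. -/

/-- A sequence of positive numbers decreasing to zero. -/
noncomputable def eps (n : ℕ) : ℝ := 1 / ((n : ℝ) + 1)

theorem eps_pos (n : ℕ) : 0 < eps n := by unfold eps; positivity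

theorem tendsto_eps : Tendsto eps atTop (𝓝 0) := tendsto_one_div_add_atTop_nhds_zero_nat

theorem eps_antitone : Antitone eps := fun m n h => by
  unfold eps; gcongr

theorem tendsto_integral_sub_logKernel :
    Tendsto (fun n => ∫ p, (heatKernel p - eps n * logKernel (eps n) p)) atTop (𝓝 1) := by
  rw [← integral_heatKernel]
  refine tendsto_integral_of_dominated_convergence (fun p => heatKernel p)
    (fun n => (heatKernel.continuous.sub
      (continuous_const.mul (continuous_logKernel (eps_pos n)))).aestronglyMeasurable)
    heatKernel.integrable (fun n => Eventually.of_forall fun p => ?_)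
    (Eventually.of_forall fun p => ?_)
  · obtain ⟨h1, h2⟩ := sub_logKernel_mem (eps_pos n) p
    rwa [Real.norm_of_nonneg h1]
  · have h : Tendsto (fun n => eps n * logKernel (eps n) p) atTop (𝓝 0) := by
      have h1 : Tendsto (fun n => 2 * Real.sqrt (heatKernel p * eps n)) atTop (𝓝 0) := by
        have := ((tendsto_eps.const_mul (heatKernel p)).sqrt).const_mul 2
        simpa using this
      exact squeeze_zero (fun n => mul_nonneg (eps_pos n).le (logKernel_nonneg (eps_pos n) p))
        (fun n => mul_logKernel_le (eps_pos n) p) h1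
    simpa using h.const_sub (heatKernel p)

/-- A zero of a nonnegative function is a minimum. The score quotients are therefore `0 / 0 = 0` on
the zero set, which is their correct value for the limits and bounds below. -/
theorem fderiv_heatKernel_of_eq_zero {p : Point} (hp : heatKernel p = 0) :
    fderiv ℝ heatKernel p = 0 := by
  have : IsLocalMin heatKernel p := Eventually.of_forall fun q => by
    rw [hp]; exact heatKernel_nonneg q
  exact this.fderiv_eq_zero

theorem schwartzX_of_eq_zero {p : Point} (hp : heatKernel p = 0) : schwartzX heatKernel p = 0 := by
  rw [schwartzX_eq_fderiv, fderiv_heatKernel_of_eq_zero hp]; rfl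

theorem schwartzY_of_eq_zero {p : Point} (hp : heatKernel p = 0) : schwartzY heatKernel p = 0 := by
  rw [schwartzY_eq_fderiv, fderiv_heatKernel_of_eq_zero hp]; rfl

theorem tendsto_div_add_eps {a h : ℝ} (ha : h = 0 → a = 0) :
    Tendsto (fun n => a / (h + eps n)) atTop (𝓝 (a / h)) := by
  by_cases hh : h = 0
  · simp [ha hh]
  · have := (tendsto_eps.const_add h)
    rw [add_zero] at this
    exact tendsto_const_nhds.div this hh

theorem div_add_eps_le {a h : ℝ} (ha : 0 ≤ a) (hh : 0 ≤ h) (ha0 : h = 0 → a = 0) (n : ℕ) :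
    a / (h + eps n) ≤ a / h := by
  rcases hh.eq_or_lt with h0 | h0
  · simp [ha0 h0.symm]
  · have := eps_pos n
    gcongr; linarith

/-- Monotone convergence in `ENNReal`, because integrability of the limit is itself a consequence of
this computation. -/
theorem lintegral_fisher :
    ∫⁻ p, ENNReal.ofReal (schwartzX heatKernel p ^ 2 / heatKernel p +
      schwartzY heatKernel p ^ 2 / heatKernel p) = ENNReal.ofReal 2 := by
  set F : ℕ → Point → ℝ := fun n p => schwartzX heatKernel p ^ 2 / (heatKernel p + eps n) +
    schwartzY heatKernel p ^ 2 / (heatKernel p + eps n) with hF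
  have hFi : ∀ n, Integrable (F n) := fun n =>
    (integrable_sq_div (eps_pos n) _).add (integrable_sq_div (eps_pos n) _)
  have hF0 : ∀ n p, 0 ≤ F n p := fun n p => by
    have := heatKernel_add_pos (eps_pos n) p
    simp only [hF]; positivity
  have h1 : Tendsto (fun n => ∫⁻ p, ENNReal.ofReal (F n p)) atTop
      (𝓝 (∫⁻ p, ENNReal.ofReal (schwartzX heatKernel p ^ 2 / heatKernel p +
        schwartzY heatKernel p ^ 2 / heatKernel p))) := by
    refine lintegral_tendsto_of_tendsto_of_monotone
      (fun n => (hFi n).aestronglyMeasurable.aemeasurable.ennreal_ofReal)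
      (Eventually.of_forall fun p m n hmn => ENNReal.ofReal_le_ofReal ?_)
      (Eventually.of_forall fun p => (ENNReal.continuous_ofReal.tendsto _).comp ?_)
    · have h3 := eps_antitone hmn
      have h4 := heatKernel_add_pos (eps_pos n) p
      simp only [hF]
      gcongr
    · exact (tendsto_div_add_eps fun h => by simp [schwartzX_of_eq_zero h]).add
        (tendsto_div_add_eps fun h => by simp [schwartzY_of_eq_zero h])
  have h2 : ∀ n, ∫⁻ p, ENNReal.ofReal (F n p) =
      ENNReal.ofReal (2 * ∫ p, (heatKernel p - eps n * logKernel (eps n) p)) := fun n => by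
    rw [← integral_gam_div_add (eps_pos n),
      ofReal_integral_eq_lintegral_ofReal (hFi n) (Eventually.of_forall (hF0 n))]
  simp only [h2] at h1
  have h3 := (ENNReal.continuous_ofReal.tendsto _).comp (tendsto_integral_sub_logKernel.const_mul 2)
  rw [mul_one] at h3
  exact tendsto_nhds_unique h1 h3

theorem measurable_sq_div (k : 𝓢(Point, ℝ)) : Measurable fun p => k p ^ 2 / heatKernel p :=
  (k.continuous.measurable.pow_const 2).div heatKernel.continuous.measurable

theorem sq_div_nonneg (k : 𝓢(Point, ℝ)) (p : Point) : 0 ≤ k p ^ 2 / heatKernel p :=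
  div_nonneg (sq_nonneg _) (heatKernel_nonneg p)

theorem integrable_fisher : Integrable fun p => schwartzX heatKernel p ^ 2 / heatKernel p +
    schwartzY heatKernel p ^ 2 / heatKernel p := by
  refine ⟨((measurable_sq_div _).add (measurable_sq_div _)).aestronglyMeasurable, ?_⟩
  rw [hasFiniteIntegral_iff_ofReal (Eventually.of_forall fun p =>
    add_nonneg (sq_div_nonneg _ p) (sq_div_nonneg _ p)), lintegral_fisher]
  exact ENNReal.ofReal_lt_top

theorem integral_fisher : ∫ p, (schwartzX heatKernel p ^ 2 / heatKernel p +
    schwartzY heatKernel p ^ 2 / heatKernel p) = 2 := by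
  rw [integral_eq_lintegral_of_nonneg_ae (Eventually.of_forall fun p =>
    add_nonneg (sq_div_nonneg _ p) (sq_div_nonneg _ p)) integrable_fisher.aestronglyMeasurable,
    lintegral_fisher, ENNReal.toReal_ofReal (by norm_num)]

theorem integrable_fisherX : Integrable fun p => schwartzX heatKernel p ^ 2 / heatKernel p :=
  integrable_fisher.mono' (measurable_sq_div _).aestronglyMeasurable
    (Eventually.of_forall fun p => by
      rw [Real.norm_of_nonneg (sq_div_nonneg _ p)]; linarith [sq_div_nonneg (schwartzY heatKernel) p])

theorem integrable_fisherY : Integrable fun p => schwartzY heatKernel p ^ 2 / heatKernel p :=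
  integrable_fisher.mono' (measurable_sq_div _).aestronglyMeasurable
    (Eventually.of_forall fun p => by
      rw [Real.norm_of_nonneg (sq_div_nonneg _ p)]; linarith [sq_div_nonneg (schwartzX heatKernel) p])

/-! ### Rotation symmetry makes the scores orthonormal. -/

/-- Quarter turn in the horizontal plane. -/
def rot (p : Point) : Point := (-p.2.1, p.1, p.2.2)

theorem measurePreserving_rot : MeasurePreserving rot := by
  have h1 : MeasurePreserving (fun w : ℝ × ℝ => (-w.2, w.1)) :=
    ((Measure.measurePreserving_neg (volume : Measure ℝ)).prod (MeasurePreserving.id volume)).comp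
      Measure.measurePreserving_swap
  have h2 := h1.prod (MeasurePreserving.id (volume : Measure ℝ))
  have h3 := measurePreserving_prodAssoc (volume : Measure ℝ) (volume : Measure ℝ) (volume : Measure ℝ)
  exact (h3.comp h2).comp (h3.symm MeasurableEquiv.prodAssoc)

theorem integral_rot (F : Point → ℝ) : ∫ p, F (rot p) = ∫ p, F p := by
  have hr : Function.LeftInverse (fun p : Point => ((p.2.1, -p.1, p.2.2) : Point)) rot := fun p => by
    simp [rot]
  have hr' : Function.RightInverse (fun p : Point => ((p.2.1, -p.1, p.2.2) : Point)) rot := fun p => by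
    simp [rot]
  let e : Point ≃ₜ Point :=
    { toFun := rot, invFun := fun p => (p.2.1, -p.1, p.2.2), left_inv := hr, right_inv := hr'
      continuous_toFun := by unfold rot; fun_prop
      continuous_invFun := by fun_prop }
  exact measurePreserving_rot.integral_comp e.measurableEmbedding F

theorem schwartzX_eq_rot (p : Point) : schwartzX heatKernel p = schwartzY heatKernel (rot p) := by
  rw [← X_schwartz, ← Y_schwartz, X, Y]
  congr 1
  funext ε
  rw [← heatKernel_rot]
  congr 1
  simp [mul, rot]

theorem schwartzY_eq_rot (p : Point) : schwartzY heatKernel p = -schwartzX heatKernel (rot p) := by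
  rw [← X_schwartz, ← Y_schwartz, X, Y]
  have h := deriv_comp_neg (fun ε : ℝ => heatKernel (mul (rot p) (ε, 0, 0))) 0
  rw [neg_zero] at h
  rw [← h]
  congr 1
  funext ε
  rw [← heatKernel_rot]
  congr 1
  simp [mul, rot]
  ring

theorem heatKernel_rot' (p : Point) : heatKernel (rot p) = heatKernel p :=
  heatKernel_rot p.1 p.2.1 p.2.2

theorem integral_fisherX : ∫ p, schwartzX heatKernel p ^ 2 / heatKernel p = 1 := by
  have h1 : ∫ p, schwartzX heatKernel p ^ 2 / heatKernel p =
      ∫ p, schwartzY heatKernel p ^ 2 / heatKernel p := by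
    rw [← integral_rot fun p => schwartzY heatKernel p ^ 2 / heatKernel p]
    simp only [heatKernel_rot', ← schwartzX_eq_rot]
  have h2 := integral_fisher
  rw [integral_add integrable_fisherX integrable_fisherY, ← h1] at h2
  linarith

theorem integral_fisherY : ∫ p, schwartzY heatKernel p ^ 2 / heatKernel p = 1 := by
  have h2 := integral_fisher
  rw [integral_add integrable_fisherX integrable_fisherY, integral_fisherX] at h2
  linarith

/-- The quarter turn sends the pair `(Xh, Yh)` to `(-Yh, Xh)`, so the integrand changes sign. -/
theorem integral_fisherXY :
    ∫ p, schwartzX heatKernel p * schwartzY heatKernel p / heatKernel p = 0 := by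
  have h := integral_rot fun p => schwartzX heatKernel p * schwartzY heatKernel p / heatKernel p
  have e : ∀ p, schwartzX heatKernel (rot p) * schwartzY heatKernel (rot p) / heatKernel (rot p) =
      -(schwartzX heatKernel p * schwartzY heatKernel p / heatKernel p) := fun p => by
    rw [heatKernel_rot', ← schwartzX_eq_rot, schwartzY_eq_rot p]; ring
  simp only [e, integral_neg] at h
  linarith

theorem integrable_fisherXY :
    Integrable fun p => schwartzX heatKernel p * schwartzY heatKernel p / heatKernel p := by
  refine integrable_fisher.mono' (((schwartzX heatKernel).continuous.mul
    (schwartzY heatKernel).continuous).measurable.div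
      heatKernel.continuous.measurable).aestronglyMeasurable (Eventually.of_forall fun p => ?_)
  rw [norm_div, Real.norm_of_nonneg (heatKernel_nonneg p), ← add_div]
  have := heatKernel_nonneg p
  gcongr
  rw [Real.norm_eq_abs, abs_mul, ← sq_abs (schwartzX heatKernel p), ← sq_abs (schwartzY heatKernel p)]
  nlinarith [sq_nonneg (|schwartzX heatKernel p| - |schwartzY heatKernel p|),
    sq_nonneg (|schwartzX heatKernel p| + |schwartzY heatKernel p|)]

/-! ### The inequality as Bessel's inequality. -/

theorem integrable_act_mul {f : Point → ℝ} (hf : Continuous f) (hc : HasCompactSupport f)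
    (k : 𝓢(Point, ℝ)) (s : ℝ) (p : Point) : Integrable fun v => f (act s p v) * k v := by
  obtain ⟨C, hC⟩ := hf.bounded_above_of_compact_support hc
  exact integrable_bdd_mul (hf.comp (continuous_act s p)) (fun v => hC _) k

theorem integral_sub_mul {f : Point → ℝ} (hf : Continuous f) (hc : HasCompactSupport f)
    {k : 𝓢(Point, ℝ)} (hk : ∫ v, k v = 0) (s : ℝ) (p : Point) (c : ℝ) :
    Integrable (fun v => (f (act s p v) - c) * k v) ∧
      ∫ v, (f (act s p v) - c) * k v = avg s k f p := by
  have e : (fun v => (f (act s p v) - c) * k v) = fun v => f (act s p v) * k v - c * k v := by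
    funext v; ring
  have i1 := integrable_act_mul hf hc k s p
  have i2 : Integrable fun v => c * k v := k.integrable.const_mul c
  rw [e]
  exact ⟨i1.sub i2, by rw [integral_sub i1 i2, integral_const_mul, hk, mul_zero, sub_zero, avg]⟩

theorem variance_eq {f : Point → ℝ} (hf : Continuous f) (hc : HasCompactSupport f) (s : ℝ)
    (p : Point) :
    Integrable (fun v => (f (act s p v) - avg s heatKernel f p) ^ 2 * heatKernel v) ∧
      ∫ v, (f (act s p v) - avg s heatKernel f p) ^ 2 * heatKernel v =
        avg s heatKernel (fun q => f q ^ 2) p - avg s heatKernel f p ^ 2 := by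
  set c := avg s heatKernel f p with hcdef
  have i1 := integrable_act_mul hf hc heatKernel s p
  have hc2 : HasCompactSupport fun q => f q ^ 2 := hc.comp_left (g := fun y : ℝ => y ^ 2) (by simp)
  have i2 : Integrable fun v => f (act s p v) ^ 2 * heatKernel v :=
    integrable_act_mul (hf.pow 2) hc2 heatKernel s p
  have i3 : Integrable fun v => c ^ 2 * heatKernel v := heatKernel.integrable.const_mul _
  have e : (fun v => (f (act s p v) - c) ^ 2 * heatKernel v) = fun v =>
      f (act s p v) ^ 2 * heatKernel v - 2 * c * (f (act s p v) * heatKernel v)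
        + c ^ 2 * heatKernel v := by
    funext v; ring
  have i12 : Integrable fun v => f (act s p v) ^ 2 * heatKernel v
      - 2 * c * (f (act s p v) * heatKernel v) := i2.sub (i1.const_mul _)
  rw [e]
  refine ⟨i12.add i3, ?_⟩
  rw [integral_add i12 i3, integral_sub i2 (i1.const_mul _), integral_const_mul, integral_const_mul,
    integral_heatKernel]
  change avg s heatKernel (fun q => f q ^ 2) p - 2 * c * avg s heatKernel f p + c ^ 2 * 1 = _
  rw [← hcdef]; ring

/-- The reverse local Poincaré inequality for averages against the heat kernel. -/
theorem reverse_poincare_avg {f : Point → ℝ} (hf : Continuous f) (hc : HasCompactSupport f) {s : ℝ}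
    (hs : 0 < s) (p : Point) :
    s ^ 2 * Gam (avg s heatKernel f) (avg s heatKernel f) p ≤
      avg s heatKernel (fun q => f q ^ 2) p - avg s heatKernel f p ^ 2 := by
  set c := avg s heatKernel f p with hcdef
  set a := avg s (schwartzX heatKernel) f p with ha
  set b := avg s (schwartzY heatKernel) f p with hb
  have hX : X (avg s heatKernel f) p = s⁻¹ * a := X_avg hf hc heatKernel hs p
  have hY : Y (avg s heatKernel f) p = s⁻¹ * b := Y_avg hf hc heatKernel hs p
  obtain ⟨iV, hV⟩ := variance_eq hf hc s p
  obtain ⟨iX, eX⟩ := integral_sub_mul hf hc (integral_schwartzX heatKernel) s p c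
  obtain ⟨iY, eY⟩ := integral_sub_mul hf hc (integral_schwartzY heatKernel) s p c
  -- The expanded form of `h (f - c - a Xh/h - b Yh/h)²`, the residual of the projection onto the
  -- scores. Its integral is the variance minus `a² + b²`.
  have hnn : ∀ v, 0 ≤ (f (act s p v) - c) ^ 2 * heatKernel v
      + (-2 * a) * ((f (act s p v) - c) * schwartzX heatKernel v)
      + (-2 * b) * ((f (act s p v) - c) * schwartzY heatKernel v)
      + a ^ 2 * (schwartzX heatKernel v ^ 2 / heatKernel v)
      + 2 * a * b * (schwartzX heatKernel v * schwartzY heatKernel v / heatKernel v)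
      + b ^ 2 * (schwartzY heatKernel v ^ 2 / heatKernel v) := by
    intro v
    rcases (heatKernel_nonneg v).eq_or_lt with h | h
    · rw [schwartzX_of_eq_zero h.symm, schwartzY_of_eq_zero h.symm, ← h]; simp
    · have : 0 ≤ ((f (act s p v) - c) * heatKernel v -
          (a * schwartzX heatKernel v + b * schwartzY heatKernel v)) ^ 2 / heatKernel v := by
        positivity
      refine this.trans (le_of_eq ?_)
      field_simp
      ring
  have h := integral_nonneg_of_ae (μ := (volume : Measure Point)) (Eventually.of_forall hnn)
  have j1 : Integrable fun v => (f (act s p v) - c) ^ 2 * heatKernel v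
      + (-2 * a) * ((f (act s p v) - c) * schwartzX heatKernel v) := iV.add (iX.const_mul _)
  have j2 : Integrable fun v => (f (act s p v) - c) ^ 2 * heatKernel v
      + (-2 * a) * ((f (act s p v) - c) * schwartzX heatKernel v)
      + (-2 * b) * ((f (act s p v) - c) * schwartzY heatKernel v) := j1.add (iY.const_mul _)
  have j3 : Integrable fun v => (f (act s p v) - c) ^ 2 * heatKernel v
      + (-2 * a) * ((f (act s p v) - c) * schwartzX heatKernel v)
      + (-2 * b) * ((f (act s p v) - c) * schwartzY heatKernel v)
      + a ^ 2 * (schwartzX heatKernel v ^ 2 / heatKernel v) := j2.add (integrable_fisherX.const_mul _)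
  have j4 : Integrable fun v => (f (act s p v) - c) ^ 2 * heatKernel v
      + (-2 * a) * ((f (act s p v) - c) * schwartzX heatKernel v)
      + (-2 * b) * ((f (act s p v) - c) * schwartzY heatKernel v)
      + a ^ 2 * (schwartzX heatKernel v ^ 2 / heatKernel v)
      + 2 * a * b * (schwartzX heatKernel v * schwartzY heatKernel v / heatKernel v) :=
    j3.add (integrable_fisherXY.const_mul _)
  rw [integral_add j4 (integrable_fisherY.const_mul _),
    integral_add j3 (integrable_fisherXY.const_mul _),
    integral_add j2 (integrable_fisherX.const_mul _), integral_add j1 (iY.const_mul _),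
    integral_add iV (iX.const_mul _), hV, integral_const_mul, integral_const_mul,
    integral_const_mul, integral_const_mul, integral_const_mul, eX, eY, integral_fisherX,
    integral_fisherY, integral_fisherXY, ← ha, ← hb] at h
  rw [Gam, hX, hY]
  have e : s ^ 2 * (s⁻¹ * a * (s⁻¹ * a) + s⁻¹ * b * (s⁻¹ * b)) = a ^ 2 + b ^ 2 := by
    field_simp
  rw [e]
  linarith

/-! ### Sharpness through approximations of the score `Xh / h`. -/

/-- A smooth cutoff function equal to one on the ball of radius `n + 1`. -/
noncomputable def cutoff (n : ℕ) : ContDiffBump (0 : Point) where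
  rIn := n + 1
  rOut := n + 2
  rIn_pos := by positivity
  rIn_lt_rOut := by linarith

/-- Smooth compactly supported approximations of the logarithmic derivative of the heat kernel. -/
noncomputable def extremal (n : ℕ) (v : Point) : ℝ :=
  cutoff n v * (schwartzX heatKernel v * (heatKernel v + eps n)⁻¹)

theorem contDiff_extremal (n : ℕ) : ContDiff ℝ ∞ (extremal n) := by
  refine (cutoff n).contDiff.mul (((schwartzX heatKernel).smooth ⊤).mul
    (((heatKernel.smooth ⊤).add contDiff_const).inv fun v => ?_))
  exact (heatKernel_add_pos (eps_pos n) v).ne'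

theorem hasCompactSupport_extremal (n : ℕ) : HasCompactSupport (extremal n) :=
  (cutoff n).hasCompactSupport.mul_right

theorem tendsto_cutoff (v : Point) : Tendsto (fun n => cutoff n v) atTop (𝓝 1) := by
  refine tendsto_const_nhds.congr' ?_
  filter_upwards [eventually_ge_atTop ⌈‖v‖⌉₊] with n hn
  refine ((cutoff n).one_of_mem_closedBall ?_).symm
  rw [mem_closedBall_zero_iff]
  have h1 := Nat.le_ceil ‖v‖
  have h2 : (⌈‖v‖⌉₊ : ℝ) ≤ n := by exact_mod_cast hn
  change ‖v‖ ≤ (n : ℝ) + 1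
  linarith

theorem extremal_mul_eq (n : ℕ) (v : Point) : extremal n v * schwartzX heatKernel v =
    cutoff n v * (schwartzX heatKernel v ^ 2 / (heatKernel v + eps n)) := by
  rw [extremal, div_eq_mul_inv]; ring

theorem tendsto_integral_extremal :
    Tendsto (fun n => ∫ v, extremal n v * schwartzX heatKernel v) atTop (𝓝 1) := by
  rw [← integral_fisherX]
  refine tendsto_integral_of_dominated_convergence
    (fun v => schwartzX heatKernel v ^ 2 / heatKernel v)
    (fun n => ((contDiff_extremal n).continuous.mul
      (schwartzX heatKernel).continuous).aestronglyMeasurable)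
    integrable_fisherX (fun n => Eventually.of_forall fun v => ?_)
    (Eventually.of_forall fun v => ?_)
  · have h1 := heatKernel_add_pos (eps_pos n) v
    have h2 : 0 ≤ schwartzX heatKernel v ^ 2 / (heatKernel v + eps n) := by positivity
    rw [extremal_mul_eq, Real.norm_of_nonneg (mul_nonneg (cutoff n).nonneg h2)]
    calc _ ≤ 1 * (schwartzX heatKernel v ^ 2 / (heatKernel v + eps n)) := by
          gcongr; exact (cutoff n).le_one
      _ ≤ _ := by
          rw [one_mul]
          exact div_add_eps_le (sq_nonneg _) (heatKernel_nonneg v)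
            (fun h => by simp [schwartzX_of_eq_zero h]) n
  · simp only [extremal_mul_eq]
    have := (tendsto_cutoff v).mul (tendsto_div_add_eps
      (a := schwartzX heatKernel v ^ 2) (h := heatKernel v)
      fun h => by simp [schwartzX_of_eq_zero h])
    simpa only [one_mul] using this

/-- Cutting off and enlarging the denominator only decrease the integrand below `(Xh)² / h`, whose
integral is one. -/
theorem integral_extremal_sq_le (n : ℕ) : ∫ v, extremal n v ^ 2 * heatKernel v ≤ 1 := by
  rw [← integral_fisherX]
  refine integral_mono_of_nonneg (Eventually.of_forall fun v =>
    mul_nonneg (sq_nonneg _) (heatKernel_nonneg v)) integrable_fisherX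
    (Eventually.of_forall fun v => ?_)
  have h0 := heatKernel_nonneg v
  have h1 := heatKernel_add_pos (eps_pos n) v
  have h2 : cutoff n v ^ 2 ≤ 1 := pow_le_one₀ (cutoff n).nonneg (cutoff n).le_one
  have h3 : heatKernel v / (heatKernel v + eps n) ≤ 1 := by
    rw [div_le_one h1]; linarith [eps_pos n]
  have h4 : 0 ≤ schwartzX heatKernel v ^ 2 / (heatKernel v + eps n) := by positivity
  calc extremal n v ^ 2 * heatKernel v = cutoff n v ^ 2 *
        (schwartzX heatKernel v ^ 2 / (heatKernel v + eps n) *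
          (heatKernel v / (heatKernel v + eps n))) := by
        rw [extremal]; field_simp
    _ ≤ 1 * (schwartzX heatKernel v ^ 2 / (heatKernel v + eps n) * 1) := by
        gcongr
    _ = schwartzX heatKernel v ^ 2 / (heatKernel v + eps n) := by ring
    _ ≤ _ := div_add_eps_le (sq_nonneg _) h0 (fun h => by simp [schwartzX_of_eq_zero h]) n

theorem contDiff_rel (s : ℝ) (p : Point) : ContDiff ℝ ∞ fun q => rel s q p := by
  unfold rel; simp only [div_eq_mul_inv]; fun_prop

/-- The constant in the reverse local Poincaré inequality is optimal. -/
theorem reverse_poincare_sharp {s : ℝ} (hs : 0 < s) (p : Point) {C : ℝ}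
    (hC : ∀ f : Point → ℝ, ContDiff ℝ ∞ f → HasCompactSupport f →
      C * (s ^ 2 * Gam (avg s heatKernel f) (avg s heatKernel f) p) ≤
        avg s heatKernel (fun q => f q ^ 2) p - avg s heatKernel f p ^ 2) : C ≤ 1 := by
  by_contra! h1
  have key : ∀ n, C * (∫ v, extremal n v * schwartzX heatKernel v) ^ 2 ≤ 1 := by
    intro n
    -- Transported so that `f (act s p v) = extremal n v`: the test function seen from `p` at scale
    -- `s` is the approximate score.
    set f : Point → ℝ := fun q => extremal n (rel s q p) with hf
    have hfs : ContDiff ℝ ∞ f := (contDiff_extremal n).comp (contDiff_rel s p)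
    have hfc : HasCompactSupport f :=
      (hasCompactSupport_extremal n).comp_homeomorph (relHomeo hs.ne' p)
    have hfa : ∀ v, f (act s p v) = extremal n v := fun v => by rw [hf]; simp only [rel_act hs.ne']
    have h2 := hC f hfs hfc
    have hX : X (avg s heatKernel f) p = s⁻¹ * ∫ v, extremal n v * schwartzX heatKernel v := by
      rw [X_avg hfs.continuous hfc heatKernel hs p, avg]
      simp only [hfa]
    have hV : avg s heatKernel (fun q => f q ^ 2) p ≤ 1 := by
      rw [avg]; simp only [hfa]; exact integral_extremal_sq_le n
    have hG : (∫ v, extremal n v * schwartzX heatKernel v) ^ 2 ≤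
        s ^ 2 * Gam (avg s heatKernel f) (avg s heatKernel f) p := by
      rw [Gam, hX]
      have e : s ^ 2 * (s⁻¹ * (∫ v, extremal n v * schwartzX heatKernel v) *
          (s⁻¹ * ∫ v, extremal n v * schwartzX heatKernel v)) =
          (∫ v, extremal n v * schwartzX heatKernel v) ^ 2 := by field_simp
      rw [mul_add, e]
      -- The `Y` part of `Gam` is discarded: the `X` part alone tends to one, which already
      -- saturates the variance bound.
      nlinarith [mul_nonneg (sq_nonneg s) (mul_self_nonneg (Y (avg s heatKernel f) p))]
    calc C * (∫ v, extremal n v * schwartzX heatKernel v) ^ 2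
        ≤ C * (s ^ 2 * Gam (avg s heatKernel f) (avg s heatKernel f) p) := by gcongr
      _ ≤ _ := h2
      _ ≤ 1 := by nlinarith [sq_nonneg (avg s heatKernel f p)]
  have hlim := (tendsto_integral_extremal.pow 2).const_mul C
  have := le_of_tendsto hlim (Eventually.of_forall key)
  linarith


end Heisenberg

open Heisenberg in
theorem mainTheorem3 :
    (∀ f : Heisenberg.Point → ℝ, ContDiff ℝ ∞ f → HasCompactSupport f →
      Heisenberg.IsHeatSolution f (fun t => Heisenberg.P t f) ∧
      (∀ u : ℝ → Heisenberg.Point → ℝ, Heisenberg.IsHeatSolution f u →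
        ∀ t : ℝ, 0 ≤ t → u t = Heisenberg.P t f) ∧
      ∀ t : ℝ, 0 ≤ t → ∀ p : Heisenberg.Point,
        t * Heisenberg.Gam (Heisenberg.P t f) (Heisenberg.P t f) p
          ≤ Heisenberg.P t (fun q => f q ^ 2) p - (Heisenberg.P t f p) ^ 2) ∧
    (∀ t : ℝ, 0 < t → ∀ p : Heisenberg.Point, ∀ C : ℝ,
      (∀ f : Heisenberg.Point → ℝ, ContDiff ℝ ∞ f → HasCompactSupport f →
        C * (t * Heisenberg.Gam (Heisenberg.P t f) (Heisenberg.P t f) p)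
          ≤ Heisenberg.P t (fun q => f q ^ 2) p - (Heisenberg.P t f p) ^ 2) →
      C ≤ 1) := by
  have hsq : ∀ {f : Point → ℝ}, HasCompactSupport f → HasCompactSupport fun q => f q ^ 2 :=
    fun hc => hc.comp_left (g := fun y : ℝ => y ^ 2) (by simp)
  refine ⟨fun f hf hc => ⟨(isHeatSolution_avg hf hc).isHeatSolution_P,
    fun u hu t ht => hu.eq_P ht, fun t ht p => ?_⟩, fun t ht p C hC => ?_⟩
  · rw [P_eq_avg hf hc ht, P_eq_avg (hf.pow 2) (hsq hc) ht]
    rcases ht.eq_or_lt with h0 | h0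
    · subst h0
      rw [avg_zero, avg_zero]
      simp
    · have := reverse_poincare_avg hf.continuous hc (Real.sqrt_pos.2 h0) p
      rwa [Real.sq_sqrt ht] at this
  · refine reverse_poincare_sharp (Real.sqrt_pos.2 ht) p fun f hf hc => ?_
    have := hC f hf hc
    rwa [P_eq_avg hf hc ht.le, P_eq_avg (hf.pow 2) (hsq hc) ht.le, ← Real.sq_sqrt ht.le,
      Real.sqrt_sq (Real.sqrt_nonneg t)] at this
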